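/- Let $N$ agents minimise $c(x)=\sum_{i=1}^N c_i(x)$ over $x\in\mathbb R^l$, where $c_i:\mathbb R^l\to\mathbb R$ is known only to agent $i$. **Network.** For $k\ge 0$ let $W(k)=[\omega_{ij}(k)]$ be nonnegative $N\times N$ matrices, and let $\mathcal E(k)=\{(j,i):\omega_{ij}(k)>0\}$ and $N_i(k)=\{j:(j,i)\in\mathcal E(k)\}$; assume $i\in N_i(k)$ for all $i,k$. Assume (A4): (a) every $W(k)$ is doubly stochastic; (b) there is $\eta\in(0,1)$ with $\omega_{ij}(k)\ge\eta$ for all $k$, $i$ and $j\in N_i(k)$; (c) the digraph with edge set $\mathcal E_\infty=\{(j,i):(j,i)\in\mathcal E(k)\text{ for infinitely many }k\}$ is strongly connected; (d) there is a positive integer $B$ such that $(j,i)\in\mathcal E(k)\cup\dots\cup\mathcal E(k+B-1)$ for all $(j,i)\in\mathcal E_\infty$ and $k\ge0$. **Algorithm (DSAAWET).** Let $x^*\in\mathbb R^l$, and let $0<M_0\le M_1\le\cdots$ with $M_k\to\infty$ and $M_0\ge\|x^*\|$. Starting from arbitrary (possibly random) $x_{i,0}$ and $\sigma_{i,0}=0$,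 put $\hat\sigma_{i,k}=\max_{j\in N_i(k)}\sigma_{j,k}$, $$x'_{i,k+1}=\Big(\sum_{j\in N_i(k)}\omega_{ij}(k)\big(x_{j,k}I_{[\sigma_{j,k}=\hat\sigma_{i,k}]}+x^*I_{[\sigma_{j,k}<\hat\sigma_{i,k}]}\big)+\gamma_kO_{i,k+1}\Big)I_{[\sigma_{i,k}=\hat\sigma_{i,k}]}+x^*I_{[\sigma_{i,k}<\hat\sigma_{i,k}]},$$ and $x_{i,k+1}=x'_{i,k+1}$, $\sigma_{i,k+1}=\hat\sigma_{i,k}$ if $\|x'_{i,k+1}\|\le M_{\hat\sigma_{i,k}}$, while $x_{i,k+1}=x^*$, $\sigma_{i,k+1}=\hat\sigma_{i,k}+1$ otherwise. The observations are the randomized Kiefer–Wolfowitz estimates $$O_{i,k+1}=-\frac{c_i(x_{i,k}+\alpha_k\Delta_{i,k})+\xi^+_{i,k+1}-c_i(x_{i,k}-\alpha_k\Delta_{i,k})-\xi^-_{i,k+1}}{2\alpha_k}\,\Delta_{i,k},$$ where, for each $i$, $(\Delta_{i,k})_{k\ge0}$ are mutually independent random vectors in $\mathbb R^l$ whose components are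 independent and equal to $\pm1$ with probability $\tfrac12$ each, and $\xi^{\pm}_{i,k+1}$ are real random variables (observation noises). **Assumptions.** C1. $\gamma_k>0$, $\sum_k\gamma_k=\infty$, and $\sum_k\gamma_k^p<\infty$ for some $p\in(1,2]$; $\alpha_k>0$ and $\alpha_k\to0$; $\sum_k\gamma_k^2/\alpha_k^2<\infty$. C2. Every $c_i$ is continuously differentiable and $\nabla c$ is locally Lipschitz; $c$ is convex with a unique global minimizer $x_{\min}$; and $\|x^*\|<c_0$, $c(x^*)<\sup_{\|x\|=c_0}c(x)$ for some $c_0>0$. C3. With $\xi_{i,k+1}=\xi^+_{i,k+1}-\xi^-_{i,k+1}$, for every $i$ and every $k\ge0$ the family $(\xi_{i,s+1})_{0\le s\le k}$ is (jointly) independent of the family $(\Delta_{i,s})_{0\le s\le k}$. Moreover, for every $i$, either there is a random variable $\bar\xi_i$ with $\sup_k|\xi_{i,k+1}|\le\bar\xi_i<\infty$ almost surely, or $\sup_kE[\xi_{i,k+1}^2]<\infty$. **Theorem.** Almost surely, $x_{i,k}\to x_{\min}$ as $k\to\infty$ for every agent $i=1,\dots,N$. -/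

import Mathlib

open MeasureTheory ProbabilityTheory Filter Topology

noncomputable section

namespace DSAAWET

/-- The neighbours of agent `i` at time `k`: those `j` with `(j, i) ∈ E(k)`, that is `ω_ij(k) > 0`. -/
def nbrs {N : ℕ} (W : ℕ → Matrix (Fin N) (Fin N) ℝ) (k : ℕ) (i : Fin N) : Finset (Fin N) :=
  Finset.univ.filter (fun j => 0 < W k i j)

/-- `(j, i)` is an edge of the limit digraph: it belongs to `E(k)` for infinitely many `k`. -/
def LimitEdge {N : ℕ} (W : ℕ → Matrix (Fin N) (Fin N) ℝ) (j i : Fin N) : Prop :=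
  ∃ᶠ k in atTop, j ∈ nbrs W k i

/-- The assumptions on the switching communication network. -/
structure NetworkCondition {N : ℕ} (W : ℕ → Matrix (Fin N) (Fin N) ℝ) : Prop where
  /-- every agent is its own neighbour at all times (standing convention on the digraphs) -/
  self_loop : ∀ k i, i ∈ nbrs W k i
  doubly_stochastic : ∀ k, W k ∈ doublyStochastic ℝ (Fin N)
  lower_bound : ∃ η : ℝ, 0 < η ∧ η < 1 ∧ ∀ k i, ∀ j ∈ nbrs W k i, η ≤ W k i j
  strongly_connected : ∀ i j, Relation.ReflTransGen (LimitEdge W) i j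
  bounded_gaps : ∃ B : ℕ, 0 < B ∧ ∀ j i, LimitEdge W j i → ∀ k, ∃ s, k ≤ s ∧ s < k + B ∧
    j ∈ nbrs W s i

/-- The truncation number `σ̂_{i,k} = max_{j ∈ N_i(k)} σ_{j,k}`. -/
def sigmaHat {N : ℕ} (W : ℕ → Matrix (Fin N) (Fin N) ℝ) (k : ℕ) (σ : Fin N → ℕ) (i : Fin N) : ℕ :=
  (nbrs W k i).sup σ

/-- The intermediate value `x'_{i,k+1}`, where `x`, `σ` are the estimates and truncation numbers of
all agents at time `k` and `o` is the observation `O_{i,k+1}`. Since `i ∈ N_i(k)`, one always has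
`σ_i ≤ σ̂_i` and `σ_j ≤ σ̂_i` for `j ∈ N_i(k)`, so each `else` branch is the case `<`. -/
def xPrime {N l : ℕ} (W : ℕ → Matrix (Fin N) (Fin N) ℝ) (γ : ℕ → ℝ)
    (xstar : EuclideanSpace ℝ (Fin l)) (k : ℕ) (x : Fin N → EuclideanSpace ℝ (Fin l))
    (σ : Fin N → ℕ) (i : Fin N) (o : EuclideanSpace ℝ (Fin l)) : EuclideanSpace ℝ (Fin l) :=
  if σ i = sigmaHat W k σ i then
    (∑ j ∈ nbrs W k i, W k i j • (if σ j = sigmaHat W k σ i then x j else xstar)) + γ k • o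
  else xstar

/-- Distributed stochastic approximation with expanding truncations: the pair
`((x_{i,k})_i, (σ_{i,k})_i)`. Here `O k x i` is the observation `O_{i,k+1}` of agent `i` when the
current estimates are `x`. -/
def algorithm {N l : ℕ} (W : ℕ → Matrix (Fin N) (Fin N) ℝ) (γ M : ℕ → ℝ)
    (xstar : EuclideanSpace ℝ (Fin l)) (x0 : Fin N → EuclideanSpace ℝ (Fin l))
    (O : ℕ → (Fin N → EuclideanSpace ℝ (Fin l)) → Fin N → EuclideanSpace ℝ (Fin l)) :
    ℕ → (Fin N → EuclideanSpace ℝ (Fin l)) × (Fin N → ℕ)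
  | 0 => (x0, fun _ => 0)
  | k + 1 =>
    let x := (algorithm W γ M xstar x0 O k).1
    let σ := (algorithm W γ M xstar x0 O k).2
    (fun i =>
        if M (sigmaHat W k σ i) < ‖xPrime W γ xstar k x σ i (O k x i)‖ then xstar
        else xPrime W γ xstar k x σ i (O k x i),
      fun i =>
        if M (sigmaHat W k σ i) < ‖xPrime W γ xstar k x σ i (O k x i)‖ then
          sigmaHat W k σ i + 1
        else sigmaHat W k σ i)

/-- The randomized Kiefer-Wolfowitz estimate of `-∇c` at `x`, with half-width `a`, direction `d`
and observation errors `ep`, `em` at `x + a d` and `x - a d`. -/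
def kwObservation {l : ℕ} (c : EuclideanSpace ℝ (Fin l) → ℝ) (a : ℝ)
    (d : EuclideanSpace ℝ (Fin l)) (ep em : ℝ) (x : EuclideanSpace ℝ (Fin l)) :
    EuclideanSpace ℝ (Fin l) :=
  -(((c (x + a • d) + ep - c (x - a • d) - em) / (2 * a)) • d)

/-- The estimate `x_{i,k}` of agent `i` at time `k` for distributed gradient-free optimization, on
one sample path: `O_{i,k+1}` is the Kiefer-Wolfowitz estimate with direction `Δ i k` and errors
`ξp i (k + 1)`, `ξm i (k + 1)`. -/
def gradientFreeEstimate {N l : ℕ} (W : ℕ → Matrix (Fin N) (Fin N) ℝ) (γ α M : ℕ → ℝ)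
    (xstar : EuclideanSpace ℝ (Fin l)) (c : Fin N → EuclideanSpace ℝ (Fin l) → ℝ)
    (x0 : Fin N → EuclideanSpace ℝ (Fin l)) (Δ : Fin N → ℕ → EuclideanSpace ℝ (Fin l))
    (ξp ξm : Fin N → ℕ → ℝ) (i : Fin N) (k : ℕ) : EuclideanSpace ℝ (Fin l) :=
  (algorithm W γ M xstar x0
    (fun m x j => kwObservation (c j) (α m) (Δ j m) (ξp j (m + 1)) (ξm j (m + 1)) (x j)) k).1 i

/-- A sequence of mutually independent random vectors in `ℝ^l`, the components of each of which are
independent and take the values `1` and `-1` with probability `1/2` each. -/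
structure IsSignSequence {l : ℕ} {Ω : Type*} [MeasurableSpace Ω]
    (D : ℕ → Ω → EuclideanSpace ℝ (Fin l)) (μ : Measure Ω) : Prop where
  measurable : ∀ k, Measurable (D k)
  indep : iIndepFun D μ
  indep_components : ∀ k, iIndepFun (fun (r : Fin l) (ω : Ω) => D k ω r) μ
  prob_one : ∀ k r, μ {ω | D k ω r = 1} = 1 / 2
  prob_neg_one : ∀ k r, μ {ω | D k ω r = -1} = 1 / 2

end DSAAWET

end

namespace DSAAWET

/-! Randomness is disposed of first; the rest is deterministic on a fixed sample path. Taylor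
expansion writes the Kiefer–Wolfowitz observation of agent `i` as `-(g + S g) + n + o(1)`, uniformly
on bounded sets, where `g` is the gradient of `c i`, `S` is the matrix `Δ Δᵀ - I` and `n` is the
noise `-ξ Δ / (2 α)`. The partial sums of `γ S` and `γ n` are L²-bounded martingales, so both series
converge almost surely (`ae_exists_tendsto_sum`). Only the directions and noises of a single agent
enter. Nothing relates different agents or the initial values, so the estimate may be correlated
with the current direction and `S g` at the estimate need not be a martingale difference. This is
why the matrices `S`, which do not involve the state, are summed instead.

The multiplicative noise is removed by summation by parts
(`AsymptoticallyUnbiased.exists_averaged_recursion`). The tails of the two convergent series define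
maps `U k`, close to the identity on bounded sets, and `U k` of the averaged estimate follows an
Euler scheme for minus the averaged gradient with relative error `ε`. By convexity this field points
towards the minimizer, so the squared distance to it drops by a multiple of `γ k` outside a small
ball (`AsymptoticallyUnbiased.exists_sq_decrease`). Mixing by doubly stochastic matrices keeps the
average and contracts the disagreement geometrically (`exists_disagreement_bound`), so the average
governs all agents.

Truncations stop (`IsTrajectory.bounded_truncations`). When a large truncation number first appears,
late in time, it reaches every agent within `D` steps, while its carriers are still near `xstar`.
From there the Lyapunov function confines the trajectory to a fixed ball, below the truncation
bound. Once the truncation numbers are constant the algorithm is a bounded perturbed consensus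
iteration. Since `∑ γ = ∞`, it enters every neighbourhood of the minimizer and stays there
(`tendsto_of_isBoundedStep`). -/

/-- Information of agent `j` at time `k` reaches agent `i` at time `k + n`. -/
def Reaches {N : ℕ} (W : ℕ → Matrix (Fin N) (Fin N) ℝ) (k : ℕ) (j : Fin N) : ℕ → Fin N → Prop
  | 0, i => j = i
  | n + 1, i => ∃ h, Reaches W k j n h ∧ h ∈ nbrs W (k + n) i

/-- The transition matrix `W(k+n-1) ⋯ W(k)`. -/
def transition {N : ℕ} (W : ℕ → Matrix (Fin N) (Fin N) ℝ) (k : ℕ) : ℕ → Matrix (Fin N) (Fin N) ℝ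
  | 0 => 1
  | n + 1 => W (k + n) * transition W k n

/-- The average of the estimates of all agents. -/
noncomputable def average {N : ℕ} {E : Type*} [AddCommGroup E] [Module ℝ E] (x : Fin N → E) : E :=
  (N : ℝ)⁻¹ • ∑ i, x i

/-! ### Information spread and geometric consensus over the switching network. -/

section Network

variable {N : ℕ} {W : ℕ → Matrix (Fin N) (Fin N) ℝ}

lemma NetworkCondition.nonneg (hW : NetworkCondition W) (k : ℕ) (i j : Fin N) : 0 ≤ W k i j :=
  nonneg_of_mem_doublyStochastic (hW.doubly_stochastic k)

lemma NetworkCondition.sum_row (hW : NetworkCondition W) (k : ℕ) (i : Fin N) :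
    ∑ j, W k i j = 1 :=
  sum_row_of_mem_doublyStochastic (hW.doubly_stochastic k) i

lemma NetworkCondition.eq_zero_of_notMem (hW : NetworkCondition W) {k : ℕ} {i j : Fin N}
    (h : j ∉ nbrs W k i) : W k i j = 0 := by
  have h0 := hW.nonneg k i j
  simp only [nbrs, Finset.mem_filter, Finset.mem_univ, true_and, not_lt] at h
  exact le_antisymm h h0

lemma NetworkCondition.sum_nbrs (hW : NetworkCondition W) {E : Type*} [AddCommGroup E] [Module ℝ E]
    (k : ℕ) (i : Fin N) (y : Fin N → E) :
    ∑ j ∈ nbrs W k i, W k i j • y j = ∑ j, W k i j • y j := by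
  apply Finset.sum_subset (Finset.subset_univ _)
  intro j _ hj
  rw [hW.eq_zero_of_notMem hj, zero_smul]

lemma Reaches.stay (hW : NetworkCondition W) {k n m : ℕ} {j i : Fin N} (h : Reaches W k j n i)
    (hnm : n ≤ m) : Reaches W k j m i := by
  induction m, hnm using Nat.le_induction with
  | base => exact h
  | succ m _ ih => exact ⟨i, ih, hW.self_loop _ _⟩

/-- Each edge of a path in the limit digraph is active within every window of length `B`, and
self-loops hold the information until then. Hence `D` does not depend on the starting time. -/
lemma exists_reaches_of_path (hW : NetworkCondition W) {j i : Fin N}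
    (h : Relation.ReflTransGen (LimitEdge W) j i) : ∃ D, ∀ k, Reaches W k j D i := by
  obtain ⟨B, hB, hgap⟩ := hW.bounded_gaps
  induction h with
  | refl => exact ⟨0, fun k => rfl⟩
  | tail _ he ih =>
    obtain ⟨D, hD⟩ := ih
    refine ⟨D + B, fun k => ?_⟩
    obtain ⟨s, hs1, hs2, hs3⟩ := hgap _ _ he (k + D)
    obtain ⟨t, rfl⟩ := Nat.exists_eq_add_of_le hs1
    have h1 := (hD k).stay hW (Nat.le_add_right D t)
    refine Reaches.stay (n := D + t + 1) hW ⟨_, h1, by rwa [← add_assoc]⟩ (by omega)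

lemma exists_reaches_all (hW : NetworkCondition W) :
    ∃ D, 0 < D ∧ ∀ k j i, Reaches W k j D i := by
  choose D hD using fun j i => exists_reaches_of_path hW (hW.strongly_connected j i)
  refine ⟨(∑ j, ∑ i, D j i) + 1, Nat.succ_pos _, fun k j i => (hD j i k).stay hW ?_⟩
  refine le_trans ?_ (Nat.le_succ _)
  exact (Finset.single_le_sum (f := fun i => D j i) (fun _ _ => Nat.zero_le _)
    (Finset.mem_univ i)).trans (Finset.single_le_sum (f := fun j => ∑ i, D j i)
    (fun _ _ => Nat.zero_le _) (Finset.mem_univ j))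

lemma transition_mem (hW : NetworkCondition W) (k n : ℕ) :
    transition W k n ∈ doublyStochastic ℝ (Fin N) := by
  induction n with
  | zero => exact one_mem _
  | succ n ih => exact mul_mem (hW.doubly_stochastic _) ih

lemma exists_transition_lower_bound (hW : NetworkCondition W) :
    ∃ D, 0 < D ∧ ∃ β : ℝ, 0 < β ∧ ∀ k i j, β ≤ transition W k D i j := by
  obtain ⟨D, hD0, hD⟩ := exists_reaches_all hW
  obtain ⟨η, hη0, hη1, hη⟩ := hW.lower_bound
  refine ⟨D, hD0, η ^ D, by positivity, fun k i j => ?_⟩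
  have key : ∀ n i, Reaches W k j n i → η ^ n ≤ transition W k n i j := by
    intro n
    induction n with
    | zero => rintro i rfl; simp [transition]
    | succ n ih =>
      rintro i ⟨h, h1, h2⟩
      rw [transition, Matrix.mul_apply, pow_succ']
      refine le_trans (mul_le_mul (hη _ _ _ h2) (ih h h1) (by positivity) (hW.nonneg _ _ _)) ?_
      exact Finset.single_le_sum (f := fun h => W (k + n) i h * transition W k n h j)
        (fun h _ => mul_nonneg (hW.nonneg _ _ _)
          (nonneg_of_mem_doublyStochastic (transition_mem hW k n))) (Finset.mem_univ h)
  exact key D i (hD k j i)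

variable {E : Type*} [NormedAddCommGroup E] [NormedSpace ℝ E]

lemma norm_sum_smul_le_of_row {w : Fin N → ℝ} (hw : ∀ j, 0 ≤ w j) (hs : ∑ j, w j = 1)
    {y : Fin N → E} {C : ℝ} (hy : ∀ j, ‖y j‖ ≤ C) : ‖∑ j, w j • y j‖ ≤ C := by
  calc ‖∑ j, w j • y j‖ ≤ ∑ j, w j * C := norm_sum_le_of_le _ fun j _ => by
        rw [norm_smul, Real.norm_of_nonneg (hw j)]
        exact mul_le_mul_of_nonneg_left (hy j) (hw j)
    _ = C := by rw [← Finset.sum_mul, hs, one_mul]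

lemma norm_sum_smul_sub_le_of_row {w : Fin N → ℝ} (hw : ∀ j, 0 ≤ w j) (hs : ∑ j, w j = 1)
    {y : Fin N → E} {z : E} {C : ℝ} (hy : ∀ j, ‖y j - z‖ ≤ C) : ‖∑ j, w j • y j - z‖ ≤ C := by
  have : ∑ j, w j • y j - z = ∑ j, w j • (y j - z) := by
    simp_rw [smul_sub, Finset.sum_sub_distrib, ← Finset.sum_smul, hs, one_smul]
  rw [this]
  exact norm_sum_smul_le_of_row hw hs hy

lemma norm_average_sub_le {y : Fin N → E} {z : E} {C : ℝ} (hN : 0 < N)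
    (hy : ∀ j, ‖y j - z‖ ≤ C) : ‖average y - z‖ ≤ C := by
  have hN' : (N : ℝ) ≠ 0 := by positivity
  have := norm_sum_smul_sub_le_of_row (w := fun _ : Fin N => (N : ℝ)⁻¹) (y := y)
    (fun _ => by positivity) (by simp [hN']) hy
  rwa [← Finset.smul_sum] at this

lemma norm_average_le {y : Fin N → E} {C : ℝ} (hN : 0 < N)
    (hy : ∀ j, ‖y j‖ ≤ C) : ‖average y‖ ≤ C := by
  have := norm_average_sub_le (z := (0 : E)) (y := y) hN (by simpa using hy)
  simpa using this

lemma average_add (x y : Fin N → E) : average (fun i => x i + y i) = average x + average y := by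
  simp [average, Finset.sum_add_distrib]

lemma average_sub (x y : Fin N → E) : average (fun i => x i - y i) = average x - average y := by
  simp [average, Finset.sum_sub_distrib, smul_sub]

lemma average_smul (a : ℝ) (x : Fin N → E) : average (fun i => a • x i) = a • average x := by
  simp [average, ← Finset.smul_sum, smul_comm a]

lemma average_mix {A : Matrix (Fin N) (Fin N) ℝ} (hA : A ∈ doublyStochastic ℝ (Fin N))
    (x : Fin N → E) : average (fun i => ∑ j, A i j • x j) = average x := by
  simp only [average]
  rw [Finset.sum_comm]
  simp_rw [← Finset.sum_smul, sum_col_of_mem_doublyStochastic hA, one_smul]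

/-- Perturbations simply add up, because row-stochastic mixing does not increase the largest norm.
-/
lemma norm_sub_transition_le (hW : NetworkCondition W) {x : ℕ → Fin N → E} {δ : ℝ} {a n : ℕ}
    (hx : ∀ k, a ≤ k → k < a + n → ∀ i, ‖x (k + 1) i - ∑ j, W k i j • x k j‖ ≤ δ) (i : Fin N) :
    ‖x (a + n) i - ∑ j, transition W a n i j • x a j‖ ≤ n * δ := by
  induction n generalizing i with
  | zero => simp [transition, Matrix.one_apply, ite_smul]
  | succ n ih =>
    have h1 := hx (a + n) (by omega) (by omega) i
    have h2 := fun i => ih (fun k hk hk' => hx k hk (by omega)) i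
    have h3 : ∑ j, transition W a (n + 1) i j • x a j =
        ∑ h, W (a + n) i h • ∑ j, transition W a n h j • x a j := by
      simp_rw [transition, Matrix.mul_apply, Finset.sum_smul, Finset.smul_sum, mul_smul]
      rw [Finset.sum_comm]
    have h4 := norm_sum_smul_le_of_row (hW.nonneg (a + n) i) (hW.sum_row (a + n) i) h2
    simp_rw [smul_sub, Finset.sum_sub_distrib] at h4
    rw [h3]
    calc _ ≤ ‖x (a + n + 1) i - ∑ j, W (a + n) i j • x (a + n) j‖ +
          ‖∑ j, W (a + n) i j • x (a + n) j -
            ∑ h, W (a + n) i h • ∑ j, transition W a n h j • x a j‖ :=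
          norm_sub_le_norm_sub_add_norm_sub ..
      _ ≤ δ + n * δ := add_le_add h1 h4
      _ = _ := by push_cast; ring

lemma norm_average_sub_average_le (hW : NetworkCondition W) (hN : 0 < N) {x : ℕ → Fin N → E} {δ : ℝ}
    {a n : ℕ}
    (hx : ∀ k, a ≤ k → k < a + n → ∀ i, ‖x (k + 1) i - ∑ j, W k i j • x k j‖ ≤ δ) :
    ‖average (x (a + n)) - average (x a)‖ ≤ n * δ := by
  rw [← average_mix (transition_mem hW a n) (x a), ← average_sub]
  exact norm_average_le hN (norm_sub_transition_le hW hx)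

lemma disagreement_le (hW : NetworkCondition W) (hN : 0 < N) {x : ℕ → Fin N → E} {δ Q : ℝ}
    {a n : ℕ}
    (hx : ∀ k, a ≤ k → k < a + n → ∀ i, ‖x (k + 1) i - ∑ j, W k i j • x k j‖ ≤ δ)
    (hQ : ∀ i, ‖x a i - average (x a)‖ ≤ Q) {β : ℝ} (hβ : ∀ i j, β ≤ transition W a n i j)
    (i : Fin N) : ‖x (a + n) i - average (x (a + n))‖ ≤ (1 - N * β) * Q + 2 * n * δ := by
  have h1 := norm_sub_transition_le hW hx i
  have h2 := norm_average_sub_average_le hW hN hx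
  have hΦ := transition_mem hW a n
  have hN' : (N : ℝ) ≠ 0 := by positivity
  have hz : ∑ j, (x a j - average (x a)) = 0 := by
    simp [Finset.sum_sub_distrib, average, ← Nat.cast_smul_eq_nsmul ℝ, smul_smul, hN']
  -- The deviations from the average sum to zero, so `β` may be subtracted from every weight. The
  -- remaining nonnegative weights have total mass `1 - N β`, which is the contraction factor.
  have h3 : ∑ j, transition W a n i j • x a j - average (x a) =
      ∑ j, (transition W a n i j - β) • (x a j - average (x a)) := by
    simp_rw [sub_smul, Finset.sum_sub_distrib, ← Finset.smul_sum, hz, smul_sub,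
      Finset.sum_sub_distrib, ← Finset.sum_smul, sum_row_of_mem_doublyStochastic hΦ]
    simp
  have h4 : ‖∑ j, transition W a n i j • x a j - average (x a)‖ ≤ (1 - N * β) * Q := by
    rw [h3]
    calc _ ≤ ∑ j, (transition W a n i j - β) * Q := norm_sum_le_of_le _ fun j _ => by
          rw [norm_smul, Real.norm_of_nonneg (sub_nonneg.2 (hβ i j))]
          exact mul_le_mul_of_nonneg_left (hQ j) (sub_nonneg.2 (hβ i j))
      _ = _ := by
          rw [← Finset.sum_mul, Finset.sum_sub_distrib, sum_row_of_mem_doublyStochastic hΦ]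
          simp
  have h5 : x (a + n) i - average (x (a + n)) =
      (x (a + n) i - ∑ j, transition W a n i j • x a j) +
      (∑ j, transition W a n i j • x a j - average (x a)) -
      (average (x (a + n)) - average (x a)) := by abel
  rw [h5]
  refine (norm_sub_le _ _).trans ?_
  have := norm_add_le (x (a + n) i - ∑ j, transition W a n i j • x a j)
      (∑ j, transition W a n i j • x a j - average (x a))
  linarith

/-- Geometric decay of the disagreement of a consensus iteration with bounded perturbations. -/
lemma exists_disagreement_bound (hW : NetworkCondition W) (hN : 0 < N) :
    ∃ D : ℕ, 0 < D ∧ ∃ ρ C : ℝ, 0 ≤ ρ ∧ ρ < 1 ∧ 0 < C ∧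
      ∀ (x : ℕ → Fin N → E) (δ Q : ℝ) (a n : ℕ), 0 ≤ δ →
        (∀ k, a ≤ k → k < a + n → ∀ i, ‖x (k + 1) i - ∑ j, W k i j • x k j‖ ≤ δ) →
        (∀ i, ‖x a i - average (x a)‖ ≤ Q) →
        ∀ i, ‖x (a + n) i - average (x (a + n))‖ ≤ ρ ^ (n / D) * (Q + C * δ) + C * δ := by
  obtain ⟨D, hD0, β, hβ0, hβ⟩ := exists_transition_lower_bound hW
  have hNβ : N * β ≤ 1 := by
    have h := sum_row_of_mem_doublyStochastic (transition_mem hW 0 D) (⟨0, hN⟩ : Fin N)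
    rw [← h]
    calc (N : ℝ) * β = ∑ j : Fin N, β := by simp
      _ ≤ _ := Finset.sum_le_sum fun j _ => hβ 0 _ j
  have hNβ0 : 0 < N * β := by positivity
  have hC0 : 0 < 2 * D / (N * β) := by positivity
  -- `C δ` is the fixed point of `q ↦ (1 - N β) q + 2 D δ`, the effect of one block of `D` steps.
  -- The `C δ` added to `Q` pays for the initial incomplete block, where only `β = 0` is available.
  refine ⟨D, hD0, 1 - N * β, 2 * D / (N * β), by linarith, by linarith, hC0, ?_⟩
  intro x δ Q a n hδ
  have hCge : 2 * (D : ℝ) ≤ 2 * D / (N * β) := by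
    rw [le_div_iff₀ hNβ0]; nlinarith [(Nat.cast_pos (α := ℝ)).2 hD0]
  induction n using Nat.strong_induction_on generalizing a Q with
  | _ n ih =>
    intro hx hQ i
    rcases lt_or_ge n D with hn | hn
    · have h1 := disagreement_le hW hN hx hQ (β := 0)
        (fun i j => nonneg_of_mem_doublyStochastic (transition_mem hW a n)) i
      rw [Nat.div_eq_of_lt hn]
      have : 2 * (n : ℝ) * δ ≤ 2 * D / (N * β) * δ := by
        refine mul_le_mul_of_nonneg_right (le_trans ?_ hCge) hδ
        have : (n : ℝ) ≤ D := by exact_mod_cast hn.le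
        linarith
      have : 0 ≤ 2 * D / (N * β) * δ := by positivity
      simp only [pow_zero, mul_zero, sub_zero, one_mul] at *
      linarith
    · obtain ⟨m, rfl⟩ := Nat.exists_eq_add_of_le' hn
      have h1 := ih m (by omega) Q a (fun k hk hk' => hx k hk (by omega)) hQ
      have h2 := disagreement_le hW hN (a := a + m) (n := D)
        (fun k hk hk' => hx k (by omega) (by omega)) h1 (hβ (a + m)) i
      rw [Nat.add_div_right _ hD0, pow_succ]
      rw [← add_assoc]
      refine h2.trans (le_of_eq ?_)
      field_simp
      ring

end Network

/-- The observations `O k i x` are, up to an error vanishing uniformly on bounded sets, of the form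
`-(G i x + S k i (G i x)) + n k i` with bounded operators `S k i` for which the series `∑ γ k S k i`
and `∑ γ k n k i` converge. -/
def AsymptoticallyUnbiased {N : ℕ} {E : Type*} [NormedAddCommGroup E] [NormedSpace ℝ E]
    (γ : ℕ → ℝ) (G : Fin N → E → E) (O : ℕ → Fin N → E → E) : Prop :=
  ∃ (S : ℕ → Fin N → E →L[ℝ] E) (n : ℕ → Fin N → E),
    (∃ C, ∀ k i, ‖S k i‖ ≤ C) ∧
    (∀ i, ∃ T, Tendsto (fun m => ∑ k ∈ Finset.range m, γ k • S k i) atTop (𝓝 T)) ∧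
    (∀ i, ∃ R, Tendsto (fun m => ∑ k ∈ Finset.range m, γ k • n k i) atTop (𝓝 R)) ∧
    ∀ K ε : ℝ, 0 < ε → ∀ᶠ k in atTop, ∀ i x, ‖x‖ ≤ K →
      ‖O k i x + (G i x + S k i (G i x)) - n k i‖ ≤ ε

/-! ### Averaged dynamics: removing the summable noise by a change of variables. -/

section Averaging

variable {E : Type*} [NormedAddCommGroup E]

lemma exists_tail {f : ℕ → E} (h : ∃ T, Tendsto (fun m => ∑ k ∈ Finset.range m, f k) atTop (𝓝 T)) :
    ∃ t : ℕ → E, Tendsto t atTop (𝓝 0) ∧ ∀ k, t k = t (k + 1) + f k := by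
  obtain ⟨T, hT⟩ := h
  refine ⟨fun m => T - ∑ k ∈ Finset.range m, f k, ?_, fun k => ?_⟩
  · simpa using hT.const_sub T
  · simp only [Finset.sum_range_succ]
    abel

variable [NormedSpace ℝ E]

/-- The gradients are merely continuous, but summation by parts needs a field whose increments are
of order `γ k` along the iterates. -/
lemma exists_lipschitzOn_approx [FiniteDimensional ℝ E] {F : Type*} [NormedAddCommGroup F]
    [NormedSpace ℝ F] {G : E → F} (hG : Continuous G) (r : ℝ) {ε : ℝ} (hε : 0 < ε) :
    ∃ (g : E → F) (L : ℝ), 0 < L ∧ (∀ x, ‖g x - G x‖ ≤ ε) ∧ (∀ x, ‖x‖ ≤ r → ‖g x‖ ≤ L) ∧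
      ∀ x y, ‖x‖ ≤ r → ‖y‖ ≤ r → ‖g x - g y‖ ≤ L * ‖x - y‖ := by
  obtain ⟨g, hg, hgG, -⟩ := hG.exists_contDiff_approx 1 (continuous_const (y := ε)) (fun _ => hε)
  have hcpt : IsCompact (Metric.closedBall (0 : E) r) := isCompact_closedBall 0 r
  obtain ⟨L, hL⟩ := LocallyLipschitzOn.exists_lipschitzOnWith_of_compact hcpt
    (ContDiff.locallyLipschitz hg).locallyLipschitzOn
  obtain ⟨B, hB⟩ := hcpt.exists_bound_of_continuousOn hg.continuous.continuousOn
  refine ⟨g, max (L : ℝ) B + 1, ?_, fun x => ?_, fun x hx => ?_, fun x y hx hy => ?_⟩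
  · have := le_max_left (L : ℝ) B
    have := L.2
    positivity
  · rw [← dist_eq_norm]; exact (hgG x).le
  · exact (hB x (by simpa using hx)).trans ((le_max_right _ _).trans (by linarith))
  · have := hL.norm_sub_le (x := x) (y := y) (by simpa using hx) (by simpa using hy)
    refine this.trans (mul_le_mul_of_nonneg_right ?_ (norm_nonneg _))
    exact (le_max_left _ _).trans (by linarith)

variable [FiniteDimensional ℝ E] {N : ℕ} {γ : ℕ → ℝ} {G : Fin N → E → E} {O : ℕ → Fin N → E → E}

lemma exists_bound_on_ball {F : Type*} [NormedAddCommGroup F] {G : E → F} (hG : Continuous G)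
    (r : ℝ) : ∃ H, 0 < H ∧ ∀ x, ‖x‖ ≤ r → ‖G x‖ ≤ H := by
  obtain ⟨B, hB⟩ := (isCompact_closedBall (0 : E) r).exists_bound_of_continuousOn hG.continuousOn
  refine ⟨|B| + 1, by positivity, fun x hx => ?_⟩
  exact (hB x (by simpa using hx)).trans ((le_abs_self B).trans (by linarith))

/-- The noise `n` itself may be unbounded, but `γ k • n k i` is a term of a convergent series. -/
lemma AsymptoticallyUnbiased.eventually_norm_le (hO : AsymptoticallyUnbiased γ G O)
    (hγ_pos : ∀ k, 0 < γ k)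
    (hγ_lim : Tendsto γ atTop (𝓝 0)) (hG : ∀ i, Continuous (G i)) (K : ℝ) {δ : ℝ} (hδ : 0 < δ) :
    ∀ᶠ k in atTop, ∀ i x, ‖x‖ ≤ K → ‖γ k • O k i x‖ ≤ δ := by
  obtain ⟨S, n, ⟨C, hC⟩, -, hn, hr⟩ := hO
  have hn0 : ∀ i, Tendsto (fun k => γ k • n k i) atTop (𝓝 0) := by
    intro i
    obtain ⟨t, ht, hts⟩ := exists_tail (hn i)
    have : (fun k => γ k • n k i) = fun k => t k - t (k + 1) := by
      funext k; rw [hts k]; abel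
    rw [this]
    simpa using ht.sub (ht.comp (tendsto_add_atTop_nat 1))
  have h1 : ∀ᶠ k in atTop, ∀ i, ‖γ k • n k i‖ < δ / 2 :=
    eventually_all.2 fun i => (hn0 i).norm.eventually_lt_const (by simpa using half_pos hδ)
  obtain ⟨H, hH0, hH⟩ := exists_bound_on_ball
    (G := fun x i => G i x) (continuous_pi hG) K
  have h2 : ∀ᶠ k in atTop, γ k * (1 + (H + C * H)) < δ / 2 := by
    have := hγ_lim.mul_const (1 + (H + C * H))
    rw [zero_mul] at this
    exact this.eventually_lt_const (half_pos hδ)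
  filter_upwards [h1, h2, hr K 1 one_pos] with k h1 h2 h3 i x hx
  have hGx : ‖G i x‖ ≤ H := (norm_le_pi_norm (fun i => G i x) i).trans (hH x hx)
  have hSG : ‖S k i (G i x)‖ ≤ C * H := (S k i).le_of_opNorm_le_of_le (hC k i) hGx
  have e : γ k • O k i x = γ k • ((O k i x + (G i x + S k i (G i x)) - n k i) -
      (G i x + S k i (G i x))) + γ k • n k i := by
    rw [← smul_add]; congr 1; abel
  have h4 : ‖(O k i x + (G i x + S k i (G i x)) - n k i) - (G i x + S k i (G i x))‖ ≤
      1 + (H + C * H) :=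
    (norm_sub_le _ _).trans (add_le_add (h3 i x hx)
      ((norm_add_le _ _).trans (add_le_add hGx hSG)))
  rw [e]
  refine (norm_add_le _ _).trans ?_
  rw [norm_smul, Real.norm_of_nonneg (hγ_pos k).le]
  have := mul_le_mul_of_nonneg_left h4 (hγ_pos k).le
  linarith [h1 i]

/-- After a vanishing change of variables the average of the estimates follows the Euler scheme of
the mean field up to a small relative error. -/
lemma AsymptoticallyUnbiased.exists_averaged_recursion (hO : AsymptoticallyUnbiased γ G O)
    (hN : 0 < N) (hγ_pos : ∀ k, 0 < γ k)
    (hγ_lim : Tendsto γ atTop (𝓝 0)) (hG : ∀ i, Continuous (G i)) (K : ℝ) {ε : ℝ} (hε : 0 < ε) :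
    ∃ (U : ℕ → E → E) (δ : ℝ), 0 < δ ∧ ∀ᶠ k in atTop,
      (∀ y, ‖y‖ ≤ K + 1 → ‖U k y - y‖ ≤ ε) ∧
      ∀ x : Fin N → E, (∀ i, ‖x i‖ ≤ K) → (∀ i, ‖x i - average x‖ ≤ δ) →
        ‖U (k + 1) (average x + γ k • average fun i => O k i (x i)) - U k (average x) +
          γ k • average fun i => G i (average x)‖ ≤ ε * γ k := by
  obtain ⟨S, n, ⟨C, hC⟩, hS, hn, hr⟩ := hO
  choose T hT0 hT using fun i => exists_tail (hS i)
  choose Rn hR0 hR using fun i => exists_tail (hn i)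
  have hC0 : 0 ≤ C := (norm_nonneg _).trans (hC 0 ⟨0, hN⟩)
  -- Three errors of size `ε₁` (observation bias, disagreement, tail operator) and one of size `2
  -- ε₁` amplified by the bound `C` of `S`.
  set ε₁ := ε / (3 + 2 * C) with hε₁
  have hε₁0 : 0 < ε₁ := by positivity
  have hGc : Continuous (fun x i => G i x : E → Fin N → E) := continuous_pi hG
  obtain ⟨H, hH0, hH⟩ := exists_bound_on_ball hGc (K + 2)
  obtain ⟨g, L, hL0, hgG, hgL, hgLip⟩ := exists_lipschitzOn_approx hGc (K + 2) hε₁0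
  have huc := (isCompact_closedBall (0 : E) (K + 2)).uniformContinuousOn_of_continuous
    hGc.continuousOn
  obtain ⟨δ, hδ0, hδ⟩ := Metric.uniformContinuousOn_iff.1 huc ε₁ hε₁0
  have hδ' : ∀ x y, ‖x‖ ≤ K + 2 → ‖y‖ ≤ K + 2 → ‖x - y‖ < δ → ∀ i, ‖G i x - G i y‖ ≤ ε₁ := by
    intro x y hx hy hxy i
    have := hδ x (by simpa using hx) y (by simpa using hy) (by rwa [dist_eq_norm])
    rw [dist_eq_norm] at this
    exact (norm_le_pi_norm (fun i => G i x - G i y) i).trans this.le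
  set B := (1 + C) * H + 1 with hB
  have hB0 : 0 < B := by positivity
  set R : ℕ → E := fun k => average fun i => Rn i k with hRdef
  have hRlim : ∀ c, 0 < c → ∀ᶠ k in atTop, ‖R k‖ ≤ c := by
    intro c hc
    have h1 : ∀ᶠ k in atTop, ∀ i, ‖Rn i k‖ < c :=
      eventually_all.2 fun i => (hR0 i).norm.eventually_lt_const (by simpa using hc)
    filter_upwards [h1] with k hk
    exact norm_average_le hN fun i => (hk i).le
  have hTlim : ∀ c, 0 < c → ∀ᶠ k in atTop, ∀ i, ‖T i k‖ ≤ c := by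
    intro c hc
    exact eventually_all.2 fun i =>
      ((hT0 i).norm.eventually_lt_const (by simpa using hc)).mono fun k hk => hk.le
  -- Adding the tail `R` absorbs the additive noise. Subtracting the tail operator `T` applied to
  -- the Lipschitz field absorbs the multiplicative noise.
  refine ⟨fun k y => y + R k - average fun i => T i k (g (y + R k) i), δ / 3, by positivity, ?_⟩
  have e1 := hRlim (min (1 / 2) (min (δ / 3) (ε / 2))) (by positivity)
  have e2 := hTlim (min (ε / (2 * L)) (ε₁ / (L * B))) (by positivity)
  have e2' := (tendsto_add_atTop_nat 1).eventually e2
  have e3 : ∀ᶠ k in atTop, γ k * B < 1 / 2 := by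
    have := hγ_lim.mul_const B
    rw [zero_mul] at this
    exact this.eventually_lt_const one_half_pos
  have e4 := hr K (min 1 ε₁) (by positivity)
  filter_upwards [e1, e2, e2', e3, e4] with k e1 e2 e2' e3 e4
  simp only [le_min_iff] at e1 e2 e2' e4
  obtain ⟨e1a, e1b, e1c⟩ := e1
  constructor
  · intro y hy
    have hz : ‖y + R k‖ ≤ K + 2 := (norm_add_le _ _).trans (by linarith)
    have h1 : ‖average fun i => T i k (g (y + R k) i)‖ ≤ ε / 2 := by
      refine norm_average_le hN fun i => ?_
      refine ((T i k).le_of_opNorm_le_of_le (e2 i).1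
        ((norm_le_pi_norm _ i).trans (hgL _ hz))).trans (le_of_eq ?_)
      field_simp
    have : y + R k - (average fun i => T i k (g (y + R k) i)) - y =
      R k - average fun i => T i k (g (y + R k) i) := by abel
    rw [this]
    exact (norm_sub_le _ _).trans (by linarith)
  · intro x hx hxδ
    set y := average x with hy
    have hyK : ‖y‖ ≤ K := norm_average_le hN hx
    set z := y + R k with hz
    have hzK : ‖z‖ ≤ K + 1 := (norm_add_le _ _).trans (by linarith)
    set v : Fin N → E := fun i => O k i (x i) - n k i with hv
    have hRk : R k = R (k + 1) + γ k • average (n k) := by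
      simp only [hRdef]
      rw [← average_smul, ← average_add]
      congr 1
      funext i
      exact hR i k
    have hz' : y + γ k • average (fun i => O k i (x i)) + R (k + 1) = z + γ k • average v := by
      rw [hz, hRk, hv, average_sub, smul_sub]
      abel
    set z' := z + γ k • average v with hz'def
    have hGx : ∀ i, ‖G i (x i)‖ ≤ H := fun i =>
      (norm_le_pi_norm (fun i' => G i' (x i)) i).trans (hH _ (by linarith [hx i]))
    have hvB : ∀ i, ‖v i‖ ≤ B := by
      intro i
      have : v i = (O k i (x i) + (G i (x i) + S k i (G i (x i))) - n k i) -
          (G i (x i) + S k i (G i (x i))) := by simp only [hv]; abel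
      rw [this]
      have h1 := (S k i).le_of_opNorm_le_of_le (hC k i) (hGx i)
      refine (norm_sub_le _ _).trans ?_
      have h2 := norm_add_le (G i (x i)) (S k i (G i (x i)))
      have h3 := (e4 i (x i) (hx i)).1
      have h4 := hGx i
      rw [hB]
      linarith
    have hzz' : ‖z' - z‖ ≤ γ k * B := by
      rw [hz'def, add_sub_cancel_left, norm_smul, Real.norm_of_nonneg (hγ_pos k).le]
      exact mul_le_mul_of_nonneg_left (norm_average_le hN hvB) (hγ_pos k).le
    have hz'K : ‖z'‖ ≤ K + 2 := by
      have : z' = z + (z' - z) := by abel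
      rw [this]
      exact (norm_add_le _ _).trans (by linarith)
    rw [hz']
    -- Summation by parts: since `T k = T (k + 1) + γ k • S k`, the change of the correction
    -- supplies `γ k • S k (g z)`, which cancels the multiplicative noise up to the continuity and
    -- approximation errors. What remains is `T (k + 1)` on an increment of order `γ k`.
    have key : z' - (average fun i => T i (k + 1) (g z' i)) -
        (z - average fun i => T i k (g z i)) + γ k • (average fun i => G i y) =
        average fun i => γ k • ((O k i (x i) + (G i (x i) + S k i (G i (x i))) - n k i) +
          (G i y - G i (x i)) + S k i (g z i - G i (x i))) - T i (k + 1) (g z' i - g z i) := by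
      have hd : z' - z = average fun i => γ k • v i := by
        rw [hz'def, add_sub_cancel_left, ← average_smul]
      have : ∀ a b c d f : E, a - c - (b - d) + f = (a - b) - c + d + f :=
        fun a b c d f => by abel
      rw [this, hd, ← average_smul, ← average_sub, ← average_add, ← average_add]
      congr 1
      funext i
      rw [hT i k]
      simp only [hv, add_apply, smul_apply, map_sub]
      module
    rw [key]
    refine norm_average_le hN fun i => ?_
    have h1 : ‖g z i - G i (x i)‖ ≤ 2 * ε₁ := by
      have h2 : ‖g z i - G i z‖ ≤ ε₁ :=
        (norm_le_pi_norm (g z - fun i => G i z) i).trans (hgG z)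
      have h3 : ‖G i z - G i (x i)‖ ≤ ε₁ := by
        refine hδ' _ _ (by linarith) (by linarith [hx i]) ?_ i
        have : z - x i = R k - (x i - y) := by rw [hz]; abel
        rw [this]
        have := norm_sub_le (R k) (x i - y)
        linarith [hxδ i]
      have := norm_sub_le_norm_sub_add_norm_sub (g z i) (G i z) (G i (x i))
      linarith
    have h2 := (S k i).le_of_opNorm_le_of_le (hC k i) h1
    have h3 : ‖G i y - G i (x i)‖ ≤ ε₁ := by
      refine hδ' _ _ (by linarith) (by linarith [hx i]) ?_ i
      rw [norm_sub_rev]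
      linarith [hxδ i]
    have h4 := (e4 i (x i) (hx i)).2
    have h5 : ‖T i (k + 1) (g z' i - g z i)‖ ≤ ε₁ * γ k := by
      have h6 : ‖g z' i - g z i‖ ≤ L * (γ k * B) :=
        (norm_le_pi_norm (g z' - g z) i).trans ((hgLip _ _ hz'K (by linarith)).trans
          (mul_le_mul_of_nonneg_left hzz' hL0.le))
      refine ((T i (k + 1)).le_of_opNorm_le_of_le (e2' i).2 h6).trans (le_of_eq ?_)
      field_simp
    have h6 : ‖(O k i (x i) + (G i (x i) + S k i (G i (x i))) - n k i) +
          (G i y - G i (x i)) + S k i (g z i - G i (x i))‖ ≤ ε₁ + ε₁ + C * (2 * ε₁) :=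
      norm_add₃_le.trans (add_le_add (add_le_add h4 h3) h2)
    refine (norm_sub_le _ _).trans ?_
    rw [norm_smul, Real.norm_of_nonneg (hγ_pos k).le]
    have h7 := mul_le_mul_of_nonneg_left h6 (hγ_pos k).le
    have h8 : ε = ε₁ * (3 + 2 * C) := by rw [hε₁]; field_simp
    rw [h8]
    linarith

end Averaging

/-! ### The squared distance to the minimizer as a Lyapunov function. -/

section Lyapunov

/-- Perpetual decrease would make the square negative because `∑ γ` diverges, so the level `r` is
reached. Afterwards each step either decreases `w` or lands below `r`. -/
lemma eventually_le_of_sq_decrease {γ w : ℕ → ℝ} (hγ_pos : ∀ k, 0 < γ k)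
    (hγ_sum : Tendsto (fun n => ∑ k ∈ Finset.range n, γ k) atTop atTop) {κ r : ℝ} (hκ : 0 < κ)
    (hw : ∀ k, 0 ≤ w k)
    (h : ∀ᶠ k in atTop, w (k + 1) ^ 2 ≤ w k ^ 2 - κ * γ k ∨ w (k + 1) ≤ r) :
    ∀ᶠ k in atTop, w k ≤ r := by
  obtain ⟨a, ha⟩ := eventually_atTop.1 h
  have hex : ∃ b, a ≤ b ∧ w b ≤ r := by
    by_contra! hcon
    have hdec : ∀ n, w (a + n) ^ 2 ≤
        w a ^ 2 - κ * (∑ k ∈ Finset.range (a + n), γ k - ∑ k ∈ Finset.range a, γ k) := by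
      intro n
      induction n with
      | zero => simp
      | succ n ih =>
        have h1 := (ha (a + n) (by omega)).resolve_right
          (not_le.2 (hcon (a + n + 1) (by omega)))
        rw [← add_assoc, Finset.sum_range_succ]
        linarith
    obtain ⟨n, hn⟩ := ((hγ_sum.comp
      (tendsto_atTop_mono (Nat.le_add_left · a) tendsto_id)).eventually_gt_atTop
        (w a ^ 2 / κ + ∑ k ∈ Finset.range a, γ k)).exists
    have h1 := hdec n
    simp only [Function.comp_apply] at hn
    have h2 : w a ^ 2 / κ < ∑ k ∈ Finset.range (a + n), γ k - ∑ k ∈ Finset.range a, γ k := by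
      linarith
    rw [div_lt_iff₀ hκ] at h2
    nlinarith [sq_nonneg (w (a + n))]
  obtain ⟨b, hab, hb⟩ := hex
  refine eventually_atTop.2 ⟨b, fun k hk => ?_⟩
  induction k, hk using Nat.le_induction with
  | base => exact hb
  | succ k hk ih =>
    rcases ha k (hab.trans hk) with h1 | h1
    · have : w (k + 1) ^ 2 ≤ w k ^ 2 := by
        have := mul_pos hκ (hγ_pos k); linarith
      exact ((pow_le_pow_iff_left₀ (hw _) (hw _) two_ne_zero).1 this).trans ih
    · exact h1

variable {E : Type*} [NormedAddCommGroup E] [InnerProductSpace ℝ E]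
  {N : ℕ} {γ : ℕ → ℝ} {G : Fin N → E → E} {O : ℕ → Fin N → E → E} {xm : E}

lemma continuous_average {F : Type*} [TopologicalSpace F] {G : Fin N → F → E}
    (hG : ∀ i, Continuous (G i)) : Continuous fun x => average fun i => G i x := by
  unfold average
  fun_prop

variable [FiniteDimensional ℝ E]

lemma exists_inner_lower_bound {h : E → E} (hh : Continuous h)
    (hpos : ∀ x, x ≠ xm → 0 < inner ℝ (h x) (x - xm)) (K : ℝ) {ρ : ℝ} (hρ : 0 < ρ) :
    ∃ κ, 0 < κ ∧ ∀ x, ‖x‖ ≤ K → ρ ≤ ‖x - xm‖ → κ ≤ inner ℝ (h x) (x - xm) := by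
  have hcpt : IsCompact (Metric.closedBall (0 : E) K ∩ {x | ρ ≤ ‖x - xm‖}) :=
    (isCompact_closedBall 0 K).inter_right (isClosed_le continuous_const (by fun_prop))
  rcases (Metric.closedBall (0 : E) K ∩ {x | ρ ≤ ‖x - xm‖}).eq_empty_or_nonempty with he | hne
  · refine ⟨1, one_pos, fun x hx hxρ => ?_⟩
    have : x ∈ Metric.closedBall (0 : E) K ∩ {x | ρ ≤ ‖x - xm‖} := ⟨by simpa using hx, hxρ⟩
    simp [he] at this
  · obtain ⟨x₀, hx₀, hmin⟩ := hcpt.exists_isMinOn hne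
      (f := fun x => inner ℝ (h x) (x - xm)) (by fun_prop)
    refine ⟨_, hpos x₀ ?_, fun x hx hxρ => hmin ⟨by simpa using hx, hxρ⟩⟩
    rintro rfl
    have := hx₀.2
    simp only [Set.mem_ofPred_eq, sub_self, norm_zero] at this
    linarith

/-- The squared distance to `xm` of the averaged iterates decreases outside a neighbourhood
of `xm`. -/
lemma AsymptoticallyUnbiased.exists_sq_decrease (hO : AsymptoticallyUnbiased γ G O)
    (hN : 0 < N) (hγ_pos : ∀ k, 0 < γ k)
    (hγ_lim : Tendsto γ atTop (𝓝 0)) (hG : ∀ i, Continuous (G i))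
    (hpos : ∀ x, x ≠ xm → 0 < inner ℝ (average fun i => G i x) (x - xm))
    {K : ℝ} (hK : 0 ≤ K) {ρ : ℝ} (hρ : 0 < ρ) :
    ∃ (U : ℕ → E → E) (δ κ : ℝ), 0 < δ ∧ 0 < κ ∧ ∀ᶠ k in atTop,
      (∀ y, ‖y‖ ≤ K + 1 → ‖U k y - y‖ ≤ ρ) ∧
      ∀ x : Fin N → E, (∀ i, ‖x i‖ ≤ K) → (∀ i, ‖x i - average x‖ ≤ δ) →
        ‖U (k + 1) (average x + γ k • average fun i => O k i (x i)) - xm‖ ^ 2 ≤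
            ‖U k (average x) - xm‖ ^ 2 - κ * γ k ∨
          ‖U (k + 1) (average x + γ k • average fun i => O k i (x i)) - xm‖ ≤ 2 * ρ := by
  have hhc := continuous_average hG
  obtain ⟨κ, hκ0, hκ⟩ := exists_inner_lower_bound hhc hpos K hρ
  obtain ⟨H, hH0, hH⟩ := exists_bound_on_ball hhc K
  set L := K + 1 + ‖xm‖ with hL
  have hL0 : 0 < L := by positivity
  -- Expanding the square gains `2 κ γ k`. The relative error costs at most `2 ε (H + L) γ k ≤ κ γ k
  -- / 2`, and the second-order term at most `κ γ k / 2`, leaving `κ γ k`.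
  set ε := min (min 1 (ρ / 2)) (κ / (4 * (H + L))) with hε
  have hε0 : 0 < ε := by positivity
  have hε1 : ε ≤ 1 := (min_le_left _ _).trans (min_le_left _ _)
  have hερ : ε ≤ ρ / 2 := (min_le_left _ _).trans (min_le_right _ _)
  have hεκ : ε * (H + L) ≤ κ / 4 := by
    have : ε ≤ κ / (4 * (H + L)) := min_le_right _ _
    rw [le_div_iff₀ (by positivity)] at this
    linarith
  obtain ⟨U, δ, hδ0, hU⟩ := hO.exists_averaged_recursion hN hγ_pos hγ_lim hG K hε0
  refine ⟨U, δ, κ, hδ0, hκ0, ?_⟩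
  have e1 : ∀ᶠ k in atTop, γ k * (H + 1) ^ 2 < κ / 2 := by
    have := hγ_lim.mul_const ((H + 1) ^ 2)
    rw [zero_mul] at this
    exact this.eventually_lt_const (half_pos hκ0)
  have e2 : ∀ᶠ k in atTop, γ k * (H + 1) < ρ / 2 := by
    have := hγ_lim.mul_const (H + 1)
    rw [zero_mul] at this
    exact this.eventually_lt_const (half_pos hρ)
  filter_upwards [hU, e1, e2] with k ⟨hU1, hU2⟩ e1 e2
  refine ⟨fun y hy => (hU1 y hy).trans (by linarith), fun x hx hxδ => ?_⟩
  have hd := hU2 x hx hxδ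
  set y := average x with hy
  have hyK : ‖y‖ ≤ K := norm_average_le hN hx
  have huy := hU1 y (by linarith)
  set h := average fun i => G i y with hh
  have hhH : ‖h‖ ≤ H := hH y hyK
  set u := U k y
  set u' := U (k + 1) (y + γ k • average fun i => O k i (x i))
  set d := u' - u + γ k • h with hddef
  have hγk := hγ_pos k
  have hq : ‖γ k • h - d‖ ≤ γ k * (H + 1) := by
    refine (norm_sub_le _ _).trans ?_
    rw [norm_smul, Real.norm_of_nonneg hγk.le]
    have := mul_le_mul_of_nonneg_left hhH hγk.le
    have := mul_le_mul_of_nonneg_right hε1 hγk.le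
    linarith
  have hu' : u' - xm = (u - xm) - (γ k • h - d) := by rw [hddef]; abel
  rcases le_or_gt ρ ‖y - xm‖ with hyρ | hyρ
  · left
    have h1 := hκ y hyK hyρ
    have h2 : inner ℝ (u - xm) (γ k • h - d) =
        γ k * (inner ℝ h (y - xm) + inner ℝ (u - y) h) - inner ℝ (u - xm) d := by
      rw [inner_sub_right, inner_smul_right, real_inner_comm (y - xm) h, ← inner_add_left]
      congr 3
      abel
    have h3 : -(ε * H) ≤ inner ℝ (u - y) h := by
      have := abs_le.1 ((abs_real_inner_le_norm (u - y) h).trans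
        (mul_le_mul huy hhH (norm_nonneg _) hε0.le))
      exact this.1
    have h4 : inner ℝ (u - xm) d ≤ L * (ε * γ k) := by
      refine (real_inner_le_norm _ _).trans (mul_le_mul ?_ hd (norm_nonneg _) hL0.le)
      have : u - xm = (u - y) + y - xm := by abel
      rw [this]
      have := norm_sub_le (u - y + y) xm
      have := norm_add_le (u - y) y
      linarith
    have h5 : ‖γ k • h - d‖ ^ 2 ≤ γ k * (κ / 2) := by
      refine (pow_le_pow_left₀ (norm_nonneg _) hq 2).trans ?_
      rw [mul_pow, sq (γ k), mul_assoc]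
      exact mul_le_mul_of_nonneg_left e1.le hγk.le
    rw [hu', norm_sub_sq_real, h2]
    have h6 : γ k * (κ - ε * H) ≤ γ k * (inner ℝ h (y - xm) + inner ℝ (u - y) h) :=
      mul_le_mul_of_nonneg_left (by linarith) hγk.le
    have h7 := mul_le_mul_of_nonneg_left hεκ hγk.le
    nlinarith
  · right
    rw [hu']
    have : u - xm - (γ k • h - d) = (u - y) + (y - xm) - (γ k • h - d) := by abel
    rw [this]
    have := norm_sub_le ((u - y) + (y - xm)) (γ k • h - d)
    have := norm_add_le (u - y) (y - xm)
    linarith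

end Lyapunov

/-! ### Confinement and convergence of trajectories without truncation. -/

section Trajectory

variable {E : Type*} [NormedAddCommGroup E] [InnerProductSpace ℝ E]
  {N : ℕ} {W : ℕ → Matrix (Fin N) (Fin N) ℝ}
  {γ : ℕ → ℝ} {G : Fin N → E → E} {O : ℕ → Fin N → E → E} {xm : E}

/-- One step of the iteration without truncations, on the ball of radius `K`. -/
def IsBoundedStep (W : ℕ → Matrix (Fin N) (Fin N) ℝ) (γ : ℕ → ℝ) (O : ℕ → Fin N → E → E) (K : ℝ)
    (x : ℕ → Fin N → E) (k : ℕ) : Prop :=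
  ∀ i, ‖x k i‖ ≤ K ∧ x (k + 1) i = ∑ j, W k i j • x k j + γ k • O k i (x k i)

lemma IsBoundedStep.average_succ (hW : NetworkCondition W) {K : ℝ} {x : ℕ → Fin N → E} {k : ℕ}
    (h : IsBoundedStep W γ O K x k) :
    average (x (k + 1)) = average (x k) + γ k • average fun i => O k i (x k i) := by
  rw [← average_mix (hW.doubly_stochastic k) (x k), ← average_smul, ← average_add]
  congr 1
  funext i
  exact (h i).2

lemma IsBoundedStep.norm_sub_le {K δ : ℝ} {x : ℕ → Fin N → E} {k : ℕ}
    (h : IsBoundedStep W γ O K x k) (hδ : ∀ i x, ‖x‖ ≤ K → ‖γ k • O k i x‖ ≤ δ) (i : Fin N) :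
    ‖x (k + 1) i - ∑ j, W k i j • x k j‖ ≤ δ := by
  rw [(h i).2, add_sub_cancel_left]
  exact hδ i _ (h i).1

lemma IsBoundedStep.norm_succ_le (hW : NetworkCondition W) {K δ : ℝ} {x : ℕ → Fin N → E} {k : ℕ}
    (h : IsBoundedStep W γ O K x k) (hδ : ∀ i x, ‖x‖ ≤ K → ‖γ k • O k i x‖ ≤ δ) (i : Fin N) :
    ‖x (k + 1) i‖ ≤ K + δ := by
  rw [(h i).2]
  exact (norm_add_le _ _).trans (add_le_add (norm_sum_smul_le_of_row (hW.nonneg k i)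
    (hW.sum_row k i) fun j => (h j).1) (hδ i _ (h i).1))

variable [FiniteDimensional ℝ E]

/-- Trajectories that start late enough near `xstar` cannot leave a fixed ball. -/
lemma exists_stays_in_ball (hW : NetworkCondition W) (hN : 0 < N)
    (hO : AsymptoticallyUnbiased γ G O) (hγ_pos : ∀ k, 0 < γ k)
    (hγ_lim : Tendsto γ atTop (𝓝 0)) (hG : ∀ i, Continuous (G i))
    (hpos : ∀ x, x ≠ xm → 0 < inner ℝ (average fun i => G i x) (x - xm)) (xstar : E) :
    ∃ K δ₀ : ℝ, ‖xstar‖ + 1 ≤ K ∧ 0 < δ₀ ∧ ∀ᶠ a in atTop, ∀ (x : ℕ → Fin N → E) (n : ℕ),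
      (∀ i, ‖x a i - xstar‖ ≤ δ₀) →
      (∀ k, a ≤ k → k < a + n → IsBoundedStep W γ O K x k) → ∀ i, ‖x (a + n) i‖ ≤ K := by
  -- The transformed average stays within `‖xstar - xm‖ + 1/2` of `xm`. Undoing the transformation
  -- costs `1/4` and the disagreement at most `1`, so the final bound lies strictly inside this
  -- ball.
  set K := ‖xm‖ + ‖xstar - xm‖ + 3 with hKdef
  have hxsK : ‖xstar‖ + 3 ≤ K := by
    have := norm_add_le (xstar - xm) xm
    rw [sub_add_cancel] at this
    linarith
  have hK : 0 ≤ K := by positivity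
  obtain ⟨U, δ, κ, hδ0, hκ0, hU⟩ := hO.exists_sq_decrease hN hγ_pos hγ_lim hG hpos hK
    (show (0 : ℝ) < 1 / 4 by norm_num)
  obtain ⟨D, -, ρ, C, hρ0, hρ1, hC0, hdis⟩ := exists_disagreement_bound (E := E) hW hN
  set η := min δ 1 with hη
  have hη0 : 0 < η := by positivity
  have hη1 : η ≤ 1 := min_le_right _ _
  set δ₁ := min 1 (η / (4 * C)) with hδ₁
  have hδ₁0 : 0 < δ₁ := by positivity
  have hδ₁C : C * δ₁ ≤ η / 4 := by
    have : δ₁ ≤ η / (4 * C) := min_le_right _ _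
    rw [le_div_iff₀ (by positivity)] at this
    linarith
  refine ⟨K, η / 4, by linarith, by positivity, ?_⟩
  obtain ⟨a₀, ha₀⟩ := eventually_atTop.1
    (hU.and (hO.eventually_norm_le hγ_pos hγ_lim hG K hδ₁0))
  refine eventually_atTop.2 ⟨a₀, fun a ha x n hxa hstep => ?_⟩
  have hQ : ∀ i, ‖x a i - average (x a)‖ ≤ η / 2 := by
    intro i
    have h1 := norm_average_sub_le hN hxa
    have h2 := norm_sub_le_norm_sub_add_norm_sub (x a i) xstar (average (x a))
    rw [norm_sub_rev xstar] at h2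
    linarith [hxa i]
  have hdisk : ∀ m, m ≤ n → ∀ i, ‖x (a + m) i - average (x (a + m))‖ ≤ η := by
    intro m hm i
    have h1 := hdis x δ₁ (η / 2) a m hδ₁0.le (fun k hk hk' =>
      (hstep k hk (by omega)).norm_sub_le (ha₀ k (ha.trans hk)).2) hQ i
    have h2 : ρ ^ (m / D) * (η / 2 + C * δ₁) ≤ 1 * (η / 2 + C * δ₁) :=
      mul_le_mul_of_nonneg_right (pow_le_one₀ hρ0 hρ1.le) (by positivity)
    linarith
  -- At the last index the bound `K` is still to be proved, so only the one-step bound `K + 1` is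
  -- available. This is why `U k` is controlled on the larger ball.
  have hball : ∀ m, m ≤ n → ∀ i, ‖x (a + m) i‖ ≤ K + 1 := by
    intro m hm i
    rcases m with _ | m
    · have := norm_add_le (x a i - xstar) xstar
      rw [sub_add_cancel] at this
      rw [add_zero]
      linarith [hxa i]
    · refine ((hstep (a + m) (by omega) (by omega)).norm_succ_le hW
        (ha₀ (a + m) (by omega)).2 i).trans ?_
      have : δ₁ ≤ 1 := min_le_left _ _
      linarith
  have hw : ∀ m, m ≤ n → ‖U (a + m) (average (x (a + m))) - xm‖ ≤ ‖xstar - xm‖ + 1 / 2 := by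
    intro m
    induction m with
    | zero =>
      intro _
      have h1 := (ha₀ a ha).1.1 _ (norm_average_le hN (hball 0 (Nat.zero_le _)))
      have h2 := norm_average_sub_le hN hxa
      simp only [add_zero] at h1 ⊢
      have e : U a (average (x a)) - xm = (U a (average (x a)) - average (x a)) +
        (average (x a) - xstar) + (xstar - xm) := by abel
      rw [e]
      refine norm_add₃_le.trans ?_
      linarith
    | succ m ih =>
      intro hm
      have hs := hstep (a + m) (by omega) (by omega)
      have h1 := (ha₀ (a + m) (by omega)).1.2 (x (a + m)) (fun i => (hs i).1)
        (fun i => (hdisk m (by omega) i).trans (min_le_left _ _))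
      rw [← hs.average_succ hW] at h1
      rw [← add_assoc]
      rcases h1 with h1 | h1
      · refine le_trans ?_ (ih (by omega))
        refine (pow_le_pow_iff_left₀ (norm_nonneg _) (norm_nonneg _) two_ne_zero).1 (h1.trans ?_)
        have := mul_pos hκ0 (hγ_pos (a + m))
        linarith
      · have := norm_nonneg (xstar - xm)
        linarith
  intro i
  have h1 := hw n le_rfl
  have h2 := hdisk n le_rfl i
  have h3 := (ha₀ (a + n) (by omega)).1.1 _ (norm_average_le hN (hball n le_rfl))
  rw [norm_sub_rev] at h3
  have e : x (a + n) i = (x (a + n) i - average (x (a + n))) +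
    (average (x (a + n)) - U (a + n) (average (x (a + n)))) +
    ((U (a + n) (average (x (a + n))) - xm) + xm) := by abel
  rw [e]
  refine norm_add₃_le.trans ?_
  have := norm_add_le (U (a + n) (average (x (a + n))) - xm) xm
  linarith

/-- Bounded trajectories without truncations converge to `xm`. -/
lemma tendsto_of_isBoundedStep (hW : NetworkCondition W)
    (hO : AsymptoticallyUnbiased γ G O) (hγ_pos : ∀ k, 0 < γ k)
    (hγ_sum : Tendsto (fun n => ∑ k ∈ Finset.range n, γ k) atTop atTop)
    (hγ_lim : Tendsto γ atTop (𝓝 0)) (hG : ∀ i, Continuous (G i))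
    (hpos : ∀ x, x ≠ xm → 0 < inner ℝ (average fun i => G i x) (x - xm))
    {K : ℝ} {x : ℕ → Fin N → E} (hstep : ∀ᶠ k in atTop, IsBoundedStep W γ O K x k)
    (i : Fin N) : Tendsto (fun k => x k i) atTop (𝓝 xm) := by
  have hN : 0 < N := i.pos
  have hK : 0 ≤ K := by
    obtain ⟨k, hk⟩ := hstep.exists
    exact (norm_nonneg _).trans (hk i).1
  obtain ⟨D, hD0, ρ, C, hρ0, hρ1, hC0, hdis⟩ := exists_disagreement_bound (E := E) hW hN
  have hcons : ∀ ε, 0 < ε → ∀ᶠ k in atTop, ∀ i, ‖x k i - average (x k)‖ ≤ ε := by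
    intro ε hε
    have hδ : 0 < ε / (2 * C) := by positivity
    obtain ⟨a, ha⟩ := eventually_atTop.1
      (hstep.and (hO.eventually_norm_le hγ_pos hγ_lim hG K hδ))
    have hlim : Tendsto (fun n => ρ ^ (n / D) * (2 * K + C * (ε / (2 * C)))) atTop (𝓝 0) := by
      have := ((tendsto_pow_atTop_nhds_zero_of_lt_one hρ0 hρ1).comp
        (Nat.tendsto_div_const_atTop hD0.ne')).mul_const (2 * K + C * (ε / (2 * C)))
      simpa using this
    obtain ⟨b, hb⟩ := eventually_atTop.1 (hlim.eventually_lt_const (half_pos hε))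
    refine eventually_atTop.2 ⟨a + b, fun k hk i => ?_⟩
    obtain ⟨n, rfl⟩ := Nat.exists_eq_add_of_le (show a ≤ k by omega)
    have h1 := hdis x _ (2 * K) a n hδ.le (fun k hk hk' =>
      (ha k hk).1.norm_sub_le (ha k hk).2) (fun i => by
        have h2 := norm_average_le hN fun i => ((ha a le_rfl).1 i).1
        have h3 := _root_.norm_sub_le (x a i) (average (x a))
        linarith [((ha a le_rfl).1 i).1]) i
    have h2 := hb n (by omega)
    have h3 : C * (ε / (2 * C)) = ε / 2 := by field_simp
    linarith
  rw [tendsto_iff_norm_sub_tendsto_zero]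
  refine Metric.tendsto_atTop.2 fun ε hε => eventually_atTop.1 ?_
  -- Disagreement and transformation cost `ε / 5` each, the Lyapunov bound `2 ε / 5`; the sum is
  -- strictly below `ε`.
  have hρ' : 0 < ε / 5 := by positivity
  obtain ⟨U, δ, κ, hδ0, hκ0, hU⟩ := hO.exists_sq_decrease hN hγ_pos hγ_lim hG hpos hK hρ'
  have hw : ∀ᶠ k in atTop, ‖U k (average (x k)) - xm‖ ≤ 2 * (ε / 5) := by
    refine eventually_le_of_sq_decrease hγ_pos hγ_sum hκ0 (fun _ => norm_nonneg _) ?_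
    filter_upwards [hU, hcons δ hδ0, hstep] with k h1 h2 h3
    rw [h3.average_succ hW]
    exact h1.2 _ (fun i => (h3 i).1) h2
  filter_upwards [hw, hU, hcons _ hρ', hstep] with k h1 h2 h3 h4
  have h5 := h2.1 (average (x k)) ((norm_average_le hN fun i => (h4 i).1).trans (by linarith))
  rw [norm_sub_rev] at h5
  have e : x k i - xm = (x k i - average (x k)) + (average (x k) - U k (average (x k))) +
    (U k (average (x k)) - xm) := by abel
  have h6 : ‖x k i - xm‖ ≤ 4 * (ε / 5) := by
    rw [e]
    refine norm_add₃_le.trans ?_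
    linarith [h3 i]
  rw [Real.dist_eq, sub_zero, abs_of_nonneg (norm_nonneg _)]
  linarith

end Trajectory

/-! ### Expanding truncations and their finiteness. -/

section Truncation

variable {N l : ℕ} {W : ℕ → Matrix (Fin N) (Fin N) ℝ} {γ M : ℕ → ℝ}
  {xstar xm : EuclideanSpace ℝ (Fin l)}
  {G : Fin N → EuclideanSpace ℝ (Fin l) → EuclideanSpace ℝ (Fin l)}
  {O : ℕ → Fin N → EuclideanSpace ℝ (Fin l) → EuclideanSpace ℝ (Fin l)}
  {x : ℕ → Fin N → EuclideanSpace ℝ (Fin l)} {σ : ℕ → Fin N → ℕ}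

/-- The sequences of estimates `x` and truncation numbers `σ` follow the recursion of the algorithm,
from arbitrary initial values. -/
structure IsTrajectory (W : ℕ → Matrix (Fin N) (Fin N) ℝ) (γ M : ℕ → ℝ)
    (xstar : EuclideanSpace ℝ (Fin l))
    (O : ℕ → Fin N → EuclideanSpace ℝ (Fin l) → EuclideanSpace ℝ (Fin l))
    (x : ℕ → Fin N → EuclideanSpace ℝ (Fin l)) (σ : ℕ → Fin N → ℕ) : Prop where
  truncated : ∀ k i, M (sigmaHat W k (σ k) i) <
      ‖xPrime W γ xstar k (x k) (σ k) i (O k i (x k i))‖ →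
    x (k + 1) i = xstar ∧ σ (k + 1) i = sigmaHat W k (σ k) i + 1
  kept : ∀ k i, ‖xPrime W γ xstar k (x k) (σ k) i (O k i (x k i))‖ ≤
      M (sigmaHat W k (σ k) i) →
    x (k + 1) i = xPrime W γ xstar k (x k) (σ k) i (O k i (x k i)) ∧
      σ (k + 1) i = sigmaHat W k (σ k) i

lemma isTrajectory_algorithm (x0 : Fin N → EuclideanSpace ℝ (Fin l)) :
    IsTrajectory W γ M xstar O
      (fun k => (algorithm W γ M xstar x0 (fun k x i => O k i (x i)) k).1)
      (fun k => (algorithm W γ M xstar x0 (fun k x i => O k i (x i)) k).2) where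
  truncated k i h := by simp only [algorithm]; exact ⟨if_pos h, if_pos h⟩
  kept k i h := by simp only [algorithm]; exact ⟨if_neg (not_lt.2 h), if_neg (not_lt.2 h)⟩

lemma le_sigmaHat {k : ℕ} {s : Fin N → ℕ} {i j : Fin N} (h : j ∈ nbrs W k i) :
    s j ≤ sigmaHat W k s i :=
  Finset.le_sup (f := s) h

lemma sigmaHat_le {k m : ℕ} {s : Fin N → ℕ} (h : ∀ j, s j ≤ m) (i : Fin N) :
    sigmaHat W k s i ≤ m :=
  Finset.sup_le fun j _ => h j

lemma IsTrajectory.sigmaHat_le_succ (hT : IsTrajectory W γ M xstar O x σ) (k : ℕ) (i : Fin N) :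
    sigmaHat W k (σ k) i ≤ σ (k + 1) i := by
  rcases lt_or_ge (M (sigmaHat W k (σ k) i))
    ‖xPrime W γ xstar k (x k) (σ k) i (O k i (x k i))‖ with h | h
  · rw [(hT.truncated k i h).2]; omega
  · rw [(hT.kept k i h).2]

/-- A truncation number rises above every neighbouring one only through a truncation, which resets
the estimate. -/
lemma IsTrajectory.eq_xstar_of_sigmaHat_lt (hT : IsTrajectory W γ M xstar O x σ) {k m : ℕ}
    {i : Fin N} (h : sigmaHat W k (σ k) i < m) :
    σ (k + 1) i ≤ m ∧ (σ (k + 1) i = m → x (k + 1) i = xstar) := by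
  rcases lt_or_ge (M (sigmaHat W k (σ k) i))
    ‖xPrime W γ xstar k (x k) (σ k) i (O k i (x k i))‖ with h1 | h1
  · obtain ⟨h2, h3⟩ := hT.truncated k i h1
    exact ⟨by omega, fun _ => h2⟩
  · obtain ⟨h2, h3⟩ := hT.kept k i h1
    exact ⟨by omega, fun _ => by omega⟩

lemma IsTrajectory.le_of_reaches (hT : IsTrajectory W γ M xstar O x σ) {k n : ℕ} {i j : Fin N}
    (h : Reaches W k j n i) : σ k j ≤ σ (k + n) i := by
  induction n generalizing i with
  | zero => obtain rfl := h; exact le_rfl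
  | succ n ih =>
    obtain ⟨h, h1, h2⟩ := h
    exact (ih h1).trans ((le_sigmaHat h2).trans (hT.sigmaHat_le_succ _ _))

lemma IsTrajectory.monotone (hW : NetworkCondition W) (hT : IsTrajectory W γ M xstar O x σ)
    (i : Fin N) : Monotone fun k => σ k i :=
  monotone_nat_of_le_succ fun k => (le_sigmaHat (hW.self_loop k i)).trans (hT.sigmaHat_le_succ k i)

lemma sigmaHat_eq (hW : NetworkCondition W) {k m : ℕ} {s : Fin N → ℕ} (h : ∀ j, s j = m)
    (i : Fin N) : sigmaHat W k s i = m :=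
  le_antisymm (sigmaHat_le (fun j => (h j).le) i) ((h i).ge.trans (le_sigmaHat (hW.self_loop k i)))

lemma xPrime_eq (hW : NetworkCondition W) {k m : ℕ} {s : Fin N → ℕ} (h : ∀ j, s j = m)
    (y : Fin N → EuclideanSpace ℝ (Fin l)) (i : Fin N) (o : EuclideanSpace ℝ (Fin l)) :
    xPrime W γ xstar k y s i o = ∑ j, W k i j • y j + γ k • o := by
  simp only [xPrime, sigmaHat_eq hW h, h, if_true]
  rw [hW.sum_nbrs]

lemma IsTrajectory.isBoundedStep (hW : NetworkCondition W) (hT : IsTrajectory W γ M xstar O x σ)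
    {k m : ℕ} {K δ : ℝ} (hσ : ∀ i, σ k i = m) (hx : ∀ i, ‖x k i‖ ≤ K)
    (hδ : ∀ i x, ‖x‖ ≤ K → ‖γ k • O k i x‖ ≤ δ) (hM : K + δ ≤ M m) :
    IsBoundedStep W γ O K x k ∧ ∀ i, σ (k + 1) i = m := by
  have key : ∀ i, ‖xPrime W γ xstar k (x k) (σ k) i (O k i (x k i))‖ ≤
      M (sigmaHat W k (σ k) i) := by
    intro i
    rw [xPrime_eq hW hσ, sigmaHat_eq hW hσ]
    refine le_trans ?_ hM
    exact (norm_add_le _ _).trans (add_le_add (norm_sum_smul_le_of_row (hW.nonneg k i)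
      (hW.sum_row k i) hx) (hδ i _ (hx i)))
  refine ⟨fun i => ⟨hx i, ?_⟩, fun i => ?_⟩
  · rw [(hT.kept k i (key i)).1, xPrime_eq hW hσ]
  · rw [(hT.kept k i (key i)).2, sigmaHat_eq hW hσ]

lemma IsTrajectory.step_of_sigma_eq (hW : NetworkCondition W)
    (hT : IsTrajectory W γ M xstar O x σ) {k m : ℕ} (hσ : ∀ i, σ k i = m)
    (hσ' : ∀ i, σ (k + 1) i = m) (i : Fin N) :
    ‖x (k + 1) i‖ ≤ M m ∧ x (k + 1) i = ∑ j, W k i j • x k j + γ k • O k i (x k i) := by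
  have h1 : ‖xPrime W γ xstar k (x k) (σ k) i (O k i (x k i))‖ ≤ M (sigmaHat W k (σ k) i) := by
    by_contra! h
    have h2 := (hT.truncated k i h).2
    rw [hσ' i, sigmaHat_eq hW hσ] at h2
    omega
  have h2 := (hT.kept k i h1).1
  rw [← h2, sigmaHat_eq hW hσ] at h1
  rw [xPrime_eq hW hσ] at h2
  exact ⟨h1, h2⟩

/-- After a new largest truncation number `m` appears, the agents with truncation number `m` remain
near `xstar` for a while. -/
lemma IsTrajectory.near_xstar (hW : NetworkCondition W) (hT : IsTrajectory W γ M xstar O x σ)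
    {τ m D : ℕ} {K δ : ℝ}
    (hσ : ∀ i, σ τ i ≤ m) (hx : ∀ i, σ τ i = m → x τ i = xstar) (hK : ‖xstar‖ + 1 ≤ K)
    (hM : K ≤ M m) (hδ0 : 0 ≤ δ) (hδD : D * δ ≤ 1)
    (hδ : ∀ k, τ ≤ k → ∀ i x, ‖x‖ ≤ K → ‖γ k • O k i x‖ ≤ δ) {s : ℕ} (hs : s ≤ D) :
    (∀ i, σ (τ + s) i ≤ m) ∧ ∀ i, σ (τ + s) i = m → ‖x (τ + s) i - xstar‖ ≤ s * δ := by
  have hnear : ∀ t : ℕ, t ≤ D → ∀ y : EuclideanSpace ℝ (Fin l), ‖y - xstar‖ ≤ t * δ → ‖y‖ ≤ K := by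
    intro t ht y hy
    have h1 : (t : ℝ) * δ ≤ D * δ :=
      mul_le_mul_of_nonneg_right (by exact_mod_cast ht) hδ0
    have h2 := norm_add_le (y - xstar) xstar
    rw [sub_add_cancel] at h2
    linarith
  induction s with
  | zero => exact ⟨hσ, fun i hi => by simp [hx i hi]⟩
  | succ s ih =>
    obtain ⟨ih1, ih2⟩ := ih (by omega)
    have key : ∀ i, σ (τ + s + 1) i ≤ m ∧
        (σ (τ + s + 1) i = m → ‖x (τ + s + 1) i - xstar‖ ≤ (s + 1 : ℕ) * δ) := by
      intro i
      rcases (sigmaHat_le (W := W) (k := τ + s) ih1 i).lt_or_eq with hlt | heq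
      · obtain ⟨h1, h2⟩ := hT.eq_xstar_of_sigmaHat_lt hlt
        refine ⟨h1, fun h => ?_⟩
        rw [h2 h, sub_self, norm_zero]
        positivity
      -- An agent that lags behind restarts at `xstar`. Otherwise it averages `xstar` with points
      -- within `s δ` of it and moves by at most `δ`. The result lies in the ball of radius `K ≤ M
      -- m`, so no truncation occurs at level `m`.
      · have hx' : ‖xPrime W γ xstar (τ + s) (x (τ + s)) (σ (τ + s)) i
            (O (τ + s) i (x (τ + s) i)) - xstar‖ ≤ (s + 1 : ℕ) * δ := by
          unfold xPrime
          split_ifs with hi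
          · rw [heq] at hi
            rw [hW.sum_nbrs, add_sub_right_comm]
            have h1 := hδ (τ + s) (by omega) i _ (hnear s (by omega) _ (ih2 i hi))
            refine (norm_add_le _ _).trans ?_
            have h2 : ‖∑ j, W (τ + s) i j • (if σ (τ + s) j = sigmaHat W (τ + s) (σ (τ + s)) i then
                x (τ + s) j else xstar) - xstar‖ ≤ s * δ := by
              refine norm_sum_smul_sub_le_of_row (hW.nonneg _ i) (hW.sum_row _ i) fun j => ?_
              split_ifs with hj
              · exact ih2 j (hj.trans heq)
              · rw [sub_self, norm_zero]; positivity
            push_cast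
            linarith
          · rw [sub_self, norm_zero]; positivity
        have h1 := hT.kept (τ + s) i (by
          rw [heq]
          exact (hnear (s + 1) hs _ hx').trans hM)
        exact ⟨by rw [h1.2, heq], fun _ => by rw [h1.1]; exact hx'⟩
    exact ⟨fun i => (key i).1, fun i => (key i).2⟩

/-- Otherwise arbitrarily large truncation numbers appear for the first time at late times. Such a
number `m` takes over the whole network near `xstar`, and confinement then forbids any further
truncation. -/
lemma IsTrajectory.bounded_truncations (hW : NetworkCondition W)
    (hT : IsTrajectory W γ M xstar O x σ)
    (hM_mono : Monotone M) (hM_top : Tendsto M atTop atTop)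
    (hO : AsymptoticallyUnbiased γ G O) (hγ_pos : ∀ k, 0 < γ k)
    (hγ_lim : Tendsto γ atTop (𝓝 0)) (hG : ∀ i, Continuous (G i))
    (hpos : ∀ x, x ≠ xm → 0 < inner ℝ (average fun i => G i x) (x - xm)) :
    ∃ m, ∀ k i, σ k i ≤ m := by
  by_contra! hunb
  obtain ⟨-, i₀, -⟩ := hunb 0
  have hN : 0 < N := i₀.pos
  obtain ⟨D, hD0, hD⟩ := exists_reaches_all hW
  obtain ⟨K, δ₀, hK, hδ₀, hstay⟩ := exists_stays_in_ball hW hN hO hγ_pos hγ_lim hG hpos xstar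
  have hD0' : (0 : ℝ) < D := by exact_mod_cast hD0
  set δ : ℝ := min 1 (min (1 / D) (δ₀ / D)) with hδdef
  have hδ0 : 0 < δ := by positivity
  have hδ1 : δ ≤ 1 := min_le_left _ _
  have hδD : D * δ ≤ 1 := by
    have : δ ≤ 1 / D := (min_le_right _ _).trans (min_le_left _ _)
    rw [le_div_iff₀ hD0'] at this
    linarith
  have hδD' : D * δ ≤ δ₀ := by
    have : δ ≤ δ₀ / D := (min_le_right _ _).trans (min_le_right _ _)
    rw [le_div_iff₀ hD0'] at this
    linarith
  obtain ⟨A, hA⟩ := eventually_atTop.1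
    (hstay.and (hO.eventually_norm_le hγ_pos hγ_lim hG K hδ0))
  obtain ⟨m₀, hm₀⟩ := (hM_top.eventually_ge_atTop (K + 1)).exists
  -- The first entry makes `M m ≥ K + 1`, leaving room for one step out of the ball; the second
  -- forces `m` to appear only after time `A`.
  set m := max m₀ (Finset.univ.sup (σ A) + 1) with hm
  have hMm : K + 1 ≤ M m := hm₀.trans (hM_mono (le_max_left _ _))
  have hex : ∃ k, ∃ i, m ≤ σ k i := by
    obtain ⟨k, i, h⟩ := hunb m
    exact ⟨k, i, h.le⟩
  classical
  obtain ⟨i₁, hi₁⟩ := Nat.find_spec hex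
  set τ := Nat.find hex with hτ
  have hτA : A < τ := by
    by_contra! hle
    have h1 : σ τ i₁ ≤ σ A i₁ := hT.monotone hW i₁ hle
    have h2 : σ A i₁ ≤ Finset.univ.sup (σ A) := Finset.le_sup (Finset.mem_univ i₁)
    have h3 : Finset.univ.sup (σ A) + 1 ≤ m := le_max_right _ _
    omega
  obtain ⟨κ, hκ⟩ : ∃ κ, τ = κ + 1 := ⟨τ - 1, by omega⟩
  have hlt : ∀ i, σ κ i < m := by
    intro i
    by_contra! h
    exact Nat.find_min hex (m := κ) (by omega) ⟨i, h⟩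
  have hm0 : 0 < m := lt_of_lt_of_le (Nat.succ_pos _) (le_max_right _ _)
  have hhat : ∀ i, sigmaHat W κ (σ κ) i < m := fun i => by
    have := sigmaHat_le (W := W) (k := κ) (s := σ κ) (m := m - 1)
      (fun j => by have := hlt j; omega) i
    omega
  have hstart : ∀ i, σ τ i ≤ m ∧ (σ τ i = m → x τ i = xstar) := fun i => by
    rw [hκ]; exact hT.eq_xstar_of_sigmaHat_lt (hhat i)
  obtain ⟨h1, h2⟩ := hT.near_xstar hW (fun i => (hstart i).1) (fun i => (hstart i).2) hK
    (by linarith) hδ0.le hδD (fun k hk => (hA k (by omega)).2) (le_refl D)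
  have hall : ∀ i, σ (τ + D) i = m := fun i =>
    le_antisymm (h1 i) (hi₁.trans (hT.le_of_reaches (hD τ i₁ i)))
  have hnear : ∀ i, ‖x (τ + D) i - xstar‖ ≤ δ₀ := fun i => (h2 i (hall i)).trans hδD'
  -- Confinement and absence of truncation feed each other: untruncated steps so far give the bound
  -- `K` now, and this bound makes the next step untruncated.
  have hforever : ∀ n, (∀ k, τ + D ≤ k → k < τ + D + n → IsBoundedStep W γ O K x k) ∧
      ∀ i, σ (τ + D + n) i = m := by
    intro n
    induction n with
    | zero => exact ⟨fun k _ _ => by omega, hall⟩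
    | succ n ih =>
      have h3 := (hA (τ + D) (by omega)).1 x n hnear ih.1
      have h4 := hT.isBoundedStep hW ih.2 h3 (hA (τ + D + n) (by omega)).2 (by linarith)
      refine ⟨fun k hk hk' => ?_, h4.2⟩
      rcases (Nat.lt_succ_iff.1 (show k < (τ + D + n) + 1 by omega)).lt_or_eq with h5 | rfl
      · exact ih.1 k hk h5
      · exact h4.1
  obtain ⟨k, i, hk⟩ := hunb m
  have h3 : σ k i ≤ σ (τ + D + k) i := hT.monotone hW i (by omega)
  have h4 := (hforever k).2 i
  omega

theorem IsTrajectory.tendsto (hW : NetworkCondition W)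
    (hT : IsTrajectory W γ M xstar O x σ)
    (hM_mono : Monotone M) (hM_top : Tendsto M atTop atTop)
    (hO : AsymptoticallyUnbiased γ G O) (hγ_pos : ∀ k, 0 < γ k)
    (hγ_sum : Tendsto (fun n => ∑ k ∈ Finset.range n, γ k) atTop atTop)
    (hγ_lim : Tendsto γ atTop (𝓝 0)) (hG : ∀ i, Continuous (G i))
    (hpos : ∀ x, x ≠ xm → 0 < inner ℝ (average fun i => G i x) (x - xm)) (i : Fin N) :
    Tendsto (fun k => x k i) atTop (𝓝 xm) := by
  obtain ⟨m', hm'⟩ := hT.bounded_truncations hW hM_mono hM_top hO hγ_pos hγ_lim hG hpos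
  obtain ⟨D, hD0, hD⟩ := exists_reaches_all hW
  have hbdd : BddAbove (Set.range fun p : ℕ × Fin N => σ p.1 p.2) :=
    ⟨m', by rintro _ ⟨p, rfl⟩; exact hm' _ _⟩
  obtain ⟨⟨k₁, i₁⟩, h1⟩ := Nat.sSup_mem ⟨σ 0 i, Set.mem_range_self (0, i)⟩ hbdd
  set m := sSup (Set.range fun p : ℕ × Fin N => σ p.1 p.2)
  have hle : ∀ k i, σ k i ≤ m := fun k i => le_csSup hbdd ⟨(k, i), rfl⟩
  have hall : ∀ k, k₁ + D ≤ k → ∀ i, σ k i = m := fun k hk i =>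
    le_antisymm (hle k i) (h1.ge.trans
      ((hT.le_of_reaches (hD k₁ i₁ i)).trans (hT.monotone hW i hk)))
  -- The extra `1` is needed because the bound `M m` on an estimate comes from the preceding step
  -- having been kept.
  refine tendsto_of_isBoundedStep hW hO hγ_pos hγ_sum hγ_lim hG hpos (K := M m)
    (eventually_atTop.2 ⟨k₁ + D + 1, fun k hk i => ⟨?_, ?_⟩⟩) i
  · obtain ⟨n, rfl⟩ : ∃ n, k = n + 1 := ⟨k - 1, by omega⟩
    exact (hT.step_of_sigma_eq hW (hall n (by omega)) (hall _ (by omega)) i).1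
  · exact (hT.step_of_sigma_eq hW (hall k (by omega)) (hall _ (by omega)) i).2

end Truncation

/-! ### Almost sure convergence of the perturbation series. -/

section Probability

variable {Ω : Type*} [mΩ : MeasurableSpace Ω] {μ : Measure Ω}

lemma IsSignSequence.measurable_apply {l : ℕ} {D : ℕ → Ω → EuclideanSpace ℝ (Fin l)}
    (hD : IsSignSequence D μ) (k : ℕ) (r : Fin l) : Measurable fun ω => D k ω r := by
  have := hD.measurable k
  fun_prop

lemma iIndepFun.indepFun_past {β : Type*} [MeasurableSpace β] {D : ℕ → Ω → β}
    (hDm : ∀ k, Measurable (D k)) (hD : iIndepFun D μ) (n : ℕ) :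
    IndepFun (fun ω (s : Fin n) => D s ω) (D n) μ := by
  have h := hD.indepFun_finset (Finset.range n) {n} (by simp) hDm
  exact h.comp (φ := fun (v : Finset.range n → β) (s : Fin n) => v ⟨s, Finset.mem_range.2 s.2⟩)
    (ψ := fun v : ({n} : Finset ℕ) → β => v ⟨n, Finset.mem_singleton_self n⟩)
    (measurable_pi_lambda _ fun s => measurable_pi_apply _)
    (measurable_pi_apply _)

variable [IsProbabilityMeasure μ]

/-- Associativity of products: the joint law is `law X ⊗ (law A ⊗ law B)`, which regroups as `(law X
⊗ law A) ⊗ law B`. -/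
lemma indepFun_prodMk_left_of_indepFun {α β δ : Type*} [MeasurableSpace α] [MeasurableSpace β]
    [MeasurableSpace δ] {X : Ω → α} {A : Ω → β} {B : Ω → δ} (hX : Measurable X) (hA : Measurable A)
    (hB : Measurable B) (h : IndepFun X (fun ω => (A ω, B ω)) μ) (hAB : IndepFun A B μ) :
    IndepFun (fun ω => (X ω, A ω)) B μ := by
  have hXA : IndepFun X A μ := h.comp measurable_id measurable_fst
  have := Measure.isProbabilityMeasure_map (μ := μ) hX.aemeasurable
  have := Measure.isProbabilityMeasure_map (μ := μ) hA.aemeasurable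
  have := Measure.isProbabilityMeasure_map (μ := μ) hB.aemeasurable
  rw [indepFun_iff_map_prod_eq_prod_map_map (by fun_prop) (by fun_prop)] at h hAB hXA ⊢
  rw [hAB] at h
  rw [hXA]
  apply MeasurableEquiv.prodAssoc.map_measurableEquiv_injective
  rw [Measure.prodAssoc_prod, ← h, Measure.map_map (by fun_prop) (by fun_prop)]
  rfl

/-- The past of the directions `D` before time `n` together with the multipliers `ζ` up to
time `n`. -/
def pastPair {β : Type*} (D : ℕ → Ω → β) (ζ : ℕ → Ω → ℝ) (n : ℕ) (ω : Ω) :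
    (Fin (n + 1) → ℝ) × (Fin n → β) :=
  (fun s => ζ s ω, fun s => D s ω)

lemma measurable_pastPair {β : Type*} [MeasurableSpace β] {D : ℕ → Ω → β} {ζ : ℕ → Ω → ℝ}
    (hDm : ∀ k, Measurable (D k)) (hζm : ∀ k, Measurable (ζ k)) (n : ℕ) :
    Measurable (pastPair D ζ n) :=
  (measurable_pi_lambda _ fun _ => hζm _).prodMk (measurable_pi_lambda _ fun _ => hDm _)

/-- The filtration generated by `pastPair`. -/
def pastFiltration {β : Type*} [MeasurableSpace β] {D : ℕ → Ω → β} {ζ : ℕ → Ω → ℝ}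
    (hDm : ∀ k, Measurable (D k)) (hζm : ∀ k, Measurable (ζ k)) :
    Filtration ℕ mΩ where
  seq n := MeasurableSpace.comap (pastPair D ζ n) inferInstance
  mono' n m hnm := by
    have e : pastPair D ζ n = (fun p : (Fin (m + 1) → ℝ) × (Fin m → β) =>
        ((fun s => p.1 (Fin.castLE (by omega) s) : Fin (n + 1) → ℝ),
          (fun s => p.2 (Fin.castLE hnm s) : Fin n → β))) ∘ pastPair D ζ m := rfl
    simp only [e, ← MeasurableSpace.comap_comp]
    refine MeasurableSpace.comap_mono (Measurable.comap_le ?_)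
    fun_prop
  le' n := (measurable_pastPair hDm hζm n).comap_le

/-- This makes `φ (D n)` independent of the sigma-algebra at time `n`, which already contains the
multiplier `ζ n` but not the direction `D n`. -/
lemma indepFun_pastPair {β : Type*} [MeasurableSpace β] {D : ℕ → Ω → β} {ζ : ℕ → Ω → ℝ}
    (hDm : ∀ k, Measurable (D k)) (hζm : ∀ k, Measurable (ζ k)) (hD : iIndepFun D μ)
    (hind : ∀ k, IndepFun (fun ω (s : Fin (k + 1)) => ζ s ω)
      (fun ω (s : Fin (k + 1)) => D s ω) μ) (n : ℕ) : IndepFun (pastPair D ζ n) (D n) μ := by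
  refine indepFun_prodMk_left_of_indepFun (measurable_pi_lambda _ fun _ => hζm _)
    (measurable_pi_lambda _ fun _ => hDm _) (hDm n) ?_ (iIndepFun.indepFun_past hDm hD n)
  exact (hind n).comp (φ := id)
    (ψ := fun v : Fin (n + 1) → β => ((fun s => v (Fin.castSucc s) : Fin n → β), v (Fin.last n)))
    measurable_id (by fun_prop)

/-- Convergence of a series of martingale differences `b k * (ζ k * φ (D k))` with independent
directions `D k` and square integrable predictable multipliers `ζ k`. -/
lemma ae_exists_tendsto_sum {β : Type*} [MeasurableSpace β] {D : ℕ → Ω → β} {ζ : ℕ → Ω → ℝ}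
    (hDm : ∀ k, Measurable (D k)) (hζm : ∀ k, Measurable (ζ k)) (hD : iIndepFun D μ)
    (hind : ∀ k, IndepFun (fun ω (s : Fin (k + 1)) => ζ s ω)
      (fun ω (s : Fin (k + 1)) => D s ω) μ)
    {φ : β → ℝ} (hφm : Measurable φ) (hφ1 : ∀ k, ∀ᵐ ω ∂μ, |φ (D k ω)| ≤ 1)
    (hφ0 : ∀ k, ∫ ω, φ (D k ω) ∂μ = 0) {C : ℝ} (hζ : ∀ k, MemLp (ζ k) 2 μ)
    (hζC : ∀ k, ∫ ω, ζ k ω ^ 2 ∂μ ≤ C) {b : ℕ → ℝ} (hb : Summable fun k => b k ^ 2) :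
    ∀ᵐ ω ∂μ, ∃ t, Tendsto (fun n => ∑ k ∈ Finset.range n, b k * (ζ k ω * φ (D k ω)))
      atTop (𝓝 t) := by
  set ℱ := pastFiltration hDm hζm with hℱ
  set f : ℕ → Ω → ℝ := fun n ω => ∑ k ∈ Finset.range n, b k * (ζ k ω * φ (D k ω)) with hf
  have hζℱ : ∀ {k n}, k ≤ n → Measurable[ℱ n] (ζ k) := by
    intro k n hkn
    have h1 : Measurable[ℱ n] (pastPair D ζ n) := comap_measurable _
    exact ((measurable_pi_apply (⟨k, by omega⟩ : Fin (n + 1))).comp measurable_fst).comp h1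
  have hDℱ : ∀ {k n}, k < n → Measurable[ℱ n] (D k) := by
    intro k n hkn
    have h1 : Measurable[ℱ n] (pastPair D ζ n) := comap_measurable _
    exact ((measurable_pi_apply (⟨k, hkn⟩ : Fin n)).comp measurable_snd).comp h1
  have hfℱ : ∀ n, Measurable[ℱ n] (f n) := by
    intro n
    refine Finset.measurable_fun_sum _ fun k hk => ?_
    have hk' := Finset.mem_range.1 hk
    exact ((hζℱ hk'.le).mul (hφm.comp (hDℱ hk'))).const_mul _
  have hind' : ∀ n, Indep (MeasurableSpace.comap (fun ω => φ (D n ω)) inferInstance) (ℱ n) μ := by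
    intro n
    have h1 := (indepFun_pastPair hDm hζm hD hind n).symm.comp hφm measurable_id
    exact (IndepFun_iff_Indep _ _ _).1 h1
  have hφD : ∀ n, Measurable (fun ω => φ (D n ω)) := fun n => hφm.comp (hDm n)
  have hX : ∀ k, MemLp (fun ω => ζ k ω * φ (D k ω)) 2 μ := by
    intro k
    refine (hζ k).of_le ((hζm k).mul (hφD k)).aestronglyMeasurable ?_
    filter_upwards [hφ1 k] with ω hω
    rw [norm_mul, Real.norm_eq_abs (φ _)]
    exact mul_le_of_le_one_right (norm_nonneg _) hω
  have hf2 : ∀ n, MemLp (f n) 2 μ := fun n => memLp_finsetSum _ fun k _ => (hX k).const_mul _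
  have hφint : ∀ n, Integrable (fun ω => φ (D n ω)) μ := by
    intro n
    refine Integrable.of_bound (hφD n).aestronglyMeasurable 1 ?_
    simpa using hφ1 n
  have hmart : Martingale f ℱ μ := by
    refine martingale_of_condExp_sub_eq_zero_nat (fun n => (hfℱ n).stronglyMeasurable)
      (fun n => (hf2 n).integrable one_le_two) fun n => ?_
    have e : f (n + 1) - f n = (fun ω => b n * ζ n ω) * (fun ω => φ (D n ω)) := by
      funext ω
      simp only [hf, Pi.sub_apply, Pi.mul_apply, Finset.sum_range_succ]
      ring
    rw [e]
    have h1 := condExp_mul_of_stronglyMeasurable_left (μ := μ) (m := ℱ n)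
      (f := fun ω => b n * ζ n ω) (g := fun ω => φ (D n ω))
      ((hζℱ le_rfl).const_mul _).stronglyMeasurable ?_ (hφint n)
    · have h2 := condExp_indep_eq (hφD n).comap_le (ℱ.le n)
        (comap_measurable (fun ω => φ (D n ω))).stronglyMeasurable (hind' n)
      filter_upwards [h1, h2] with ω h1 h2
      rw [h1, Pi.mul_apply, h2, hφ0, mul_zero]
      rfl
    · refine (((hX n).integrable one_le_two).const_mul (b n)).congr
        (Eventually.of_forall fun ω => ?_)
      simp only [Pi.mul_apply]
      ring
  -- Orthogonality of increments: the cross term vanishes because `f n * ζ n` is independent of the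
  -- centred `φ (D n)`.
  have hsq : ∀ n, ∫ ω, f n ω ^ 2 ∂μ ≤ ∑ k ∈ Finset.range n, b k ^ 2 * C := by
    intro n
    induction n with
    | zero => simp [hf]
    | succ n ih =>
      have h1 : Indep (MeasurableSpace.comap (fun ω => f n ω * ζ n ω) inferInstance)
          (MeasurableSpace.comap (fun ω => φ (D n ω)) inferInstance) μ :=
        indep_of_indep_of_le_left (hind' n).symm ((hfℱ n).mul (hζℱ le_rfl)).comap_le
      have h2 := IndepFun.integral_fun_mul_eq_mul_integral ((IndepFun_iff_Indep _ _ _).2 h1)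
        (((hfℱ n).mono (ℱ.le n) le_rfl).mul (hζm n)).aestronglyMeasurable
        (hφD n).aestronglyMeasurable
      rw [hφ0, mul_zero] at h2
      have e : ∀ ω, f (n + 1) ω ^ 2 = f n ω ^ 2 + 2 * b n * (f n ω * ζ n ω * φ (D n ω)) +
          b n ^ 2 * (ζ n ω * φ (D n ω)) ^ 2 := by
        intro ω
        simp only [hf, Finset.sum_range_succ]
        ring
      have i1 : Integrable (fun ω => f n ω ^ 2) μ := (hf2 n).integrable_sq
      have i2 : Integrable (fun ω => 2 * b n * (f n ω * ζ n ω * φ (D n ω))) μ := by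
        refine (((hf2 n).integrable_mul (hX n)).const_mul (2 * b n)).congr
          (Eventually.of_forall fun ω => ?_)
        simp only [Pi.mul_apply]
        ring
      have i3 : Integrable (fun ω => b n ^ 2 * (ζ n ω * φ (D n ω)) ^ 2) μ :=
        (hX n).integrable_sq.const_mul _
      have i12 : Integrable (fun ω => f n ω ^ 2 + 2 * b n * (f n ω * ζ n ω * φ (D n ω))) μ :=
        i1.add i2
      simp_rw [e]
      rw [integral_add i12 i3, integral_add i1 i2, integral_const_mul, integral_const_mul,
        h2, mul_zero, add_zero, Finset.sum_range_succ]
      refine add_le_add ih (mul_le_mul_of_nonneg_left (le_trans ?_ (hζC n)) (sq_nonneg _))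
      refine integral_mono_ae (hX n).integrable_sq (hζ n).integrable_sq ?_
      filter_upwards [hφ1 n] with ω hω
      rw [mul_pow]
      exact mul_le_of_le_one_right (sq_nonneg _) ((sq_le_one_iff_abs_le_one _).2 hω)
  have hC0 : 0 ≤ C := (integral_nonneg fun ω => sq_nonneg _).trans (hζC 0)
  have hbound : ∀ n, eLpNorm (f n) 1 μ ≤
      ((Real.toNNReal (1 + (∑' k, b k ^ 2) * C) : NNReal) : ENNReal) := by
    intro n
    rw [eLpNorm_one_eq_lintegral_enorm]
    have h1 : ∫⁻ ω, ‖f n ω‖ₑ ∂μ = ENNReal.ofReal (∫ ω, ‖f n ω‖ ∂μ) :=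
      (ofReal_integral_norm_eq_lintegral_enorm ((hf2 n).integrable one_le_two)).symm
    rw [h1]
    refine ENNReal.ofReal_le_ofReal ?_
    have h2 : ∫ ω, ‖f n ω‖ ∂μ ≤ ∫ ω, (1 + f n ω ^ 2) ∂μ := by
      refine integral_mono ((hf2 n).integrable one_le_two).norm
        ((integrable_const 1).add (hf2 n).integrable_sq) fun ω => ?_
      simp only [Real.norm_eq_abs]
      nlinarith [sq_nonneg (|f n ω| - 1), sq_abs (f n ω)]
    rw [integral_add (integrable_const 1) (hf2 n).integrable_sq] at h2
    have h3 : ∑ k ∈ Finset.range n, b k ^ 2 * C ≤ (∑' k, b k ^ 2) * C := by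
      rw [← Finset.sum_mul]
      exact mul_le_mul_of_nonneg_right (hb.sum_le_tsum _ fun _ _ => sq_nonneg _) hC0
    simp only [integral_const, probReal_univ, smul_eq_mul, one_mul] at h2
    linarith [hsq n]
  exact hmart.submartingale.exists_ae_tendsto_of_bdd hbound

variable {l : ℕ} {D : ℕ → Ω → EuclideanSpace ℝ (Fin l)}

lemma IsSignSequence.ae_eq (hD : IsSignSequence D μ) :
    ∀ᵐ ω ∂μ, ∀ k r, D k ω r = 1 ∨ D k ω r = -1 := by
  refine ae_all_iff.2 fun k => ae_all_iff.2 fun r => ?_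
  have hm := hD.measurable_apply k r
  have h1 : MeasurableSet {ω | D k ω r = 1} := hm (measurableSet_singleton 1)
  have h2 : MeasurableSet {ω | D k ω r = -1} := hm (measurableSet_singleton (-1))
  have hdisj : Disjoint {ω | D k ω r = 1} {ω | D k ω r = -1} := by
    rw [Set.disjoint_left]
    intro ω hω hω'
    simp only [Set.mem_ofPred_eq] at hω hω'
    linarith
  have h3 : μ ({ω | D k ω r = 1} ∪ {ω | D k ω r = -1}) = 1 := by
    rw [measure_union hdisj h2, hD.prob_one, hD.prob_neg_one, ENNReal.add_halves]
  have h4 := (prob_compl_eq_zero_iff (h1.union h2)).2 h3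
  exact h4

lemma IsSignSequence.integral_apply (hD : IsSignSequence D μ) (k : ℕ) (r : Fin l) :
    ∫ ω, D k ω r ∂μ = 0 := by
  have hm := hD.measurable_apply k r
  have h1 : MeasurableSet {ω | D k ω r = 1} := hm (measurableSet_singleton 1)
  have h2 : MeasurableSet {ω | D k ω r = -1} := hm (measurableSet_singleton (-1))
  have e : (fun ω => D k ω r) =ᵐ[μ] fun ω => {ω | D k ω r = 1}.indicator (fun _ => (1 : ℝ)) ω -
      {ω | D k ω r = -1}.indicator (fun _ => (1 : ℝ)) ω := by
    filter_upwards [hD.ae_eq] with ω hω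
    rcases hω k r with h | h <;> norm_num [Set.indicator, h]
  rw [integral_congr_ae e, integral_sub ((integrable_const _).indicator h1)
    ((integrable_const _).indicator h2), integral_indicator h1, integral_indicator h2]
  simp [Measure.real, hD.prob_one, hD.prob_neg_one]

lemma IsSignSequence.integral_mul (hD : IsSignSequence D μ) (k : ℕ) {r s : Fin l} (hrs : r ≠ s) :
    ∫ ω, D k ω r * D k ω s ∂μ = 0 := by
  rw [((hD.indep_components k).indepFun hrs).integral_fun_mul_eq_mul_integral
    (hD.measurable_apply k r).aestronglyMeasurable (hD.measurable_apply k s).aestronglyMeasurable,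
    hD.integral_apply, zero_mul]

/-- The diagonal terms vanish since signs square to one. The off-diagonal products are centred by
independence of the components, and the martingale result applies with multiplier `1`. -/
lemma IsSignSequence.ae_tendsto_sum_mul (hD : IsSignSequence D μ) {b : ℕ → ℝ}
    (hb : Summable fun k => b k ^ 2) :
    ∀ᵐ ω ∂μ, ∀ r s, ∃ t, Tendsto (fun n => ∑ k ∈ Finset.range n,
      b k * (D k ω r * D k ω s - if r = s then 1 else 0)) atTop (𝓝 t) := by
  refine ae_all_iff.2 fun r => ae_all_iff.2 fun s => ?_
  by_cases hrs : r = s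
  · subst hrs
    filter_upwards [hD.ae_eq] with ω hω
    refine ⟨0, tendsto_const_nhds.congr fun n => (Finset.sum_eq_zero fun k _ => ?_).symm⟩
    rcases hω k r with h | h <;> simp [h]
  · have h := ae_exists_tendsto_sum (μ := μ) (ζ := fun _ _ => 1)
      (φ := fun d : EuclideanSpace ℝ (Fin l) => d r * d s) (C := 1)
      hD.measurable (fun _ => measurable_const) hD.indep
      (fun k => indepFun_const_left _ _) (by fun_prop)
      (fun k => hD.ae_eq.mono fun ω hω => by
        rcases hω k r with h | h <;> rcases hω k s with h' | h' <;> simp [h, h'])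
      (fun k => hD.integral_mul k hrs) (fun _ => memLp_const 1) (by simp) hb
    simpa [hrs] using h

lemma IsSignSequence.ae_tendsto_sum_noise (hD : IsSignSequence D μ) {b : ℕ → ℝ}
    (hb : Summable fun k => b k ^ 2) {ξ : ℕ → Ω → ℝ} (hξm : ∀ k, Measurable (ξ k))
    (hind : ∀ k, IndepFun (fun ω (s : Fin (k + 1)) => ξ s ω)
      (fun ω (s : Fin (k + 1)) => D s ω) μ)
    (hξ : (∃ ξbar : Ω → ℝ, ∀ᵐ ω ∂μ, ∀ k, |ξ k ω| ≤ ξbar ω) ∨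
      (⨆ k, ∫⁻ ω, ENNReal.ofReal (ξ k ω ^ 2) ∂μ) < ⊤) :
    ∀ᵐ ω ∂μ, ∀ r, ∃ t, Tendsto (fun n => ∑ k ∈ Finset.range n, b k * (ξ k ω * D k ω r))
      atTop (𝓝 t) := by
  refine ae_all_iff.2 fun r => ?_
  have hφ1 : ∀ k, ∀ᵐ ω ∂μ, |D k ω r| ≤ 1 := fun k => hD.ae_eq.mono fun ω hω => by
    rcases hω k r with h | h <;> simp [h]
  have hφm : Measurable fun d : EuclideanSpace ℝ (Fin l) => d r := by fun_prop
  rcases hξ with ⟨ξbar, hbar⟩ | hξ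
  -- A random bound need not be integrable, so the noise is cut off at each natural level `m`.
  -- Almost surely all countably many truncated series converge, and for `m ≥ ξbar ω` the cutoff
  -- changes nothing.
  · set ψ : ℕ → ℝ → ℝ := fun m t => if |t| ≤ m then t else 0 with hψ
    have hψm : ∀ m, Measurable (ψ m) := fun m =>
      Measurable.ite (measurableSet_le measurable_abs measurable_const) measurable_id
        measurable_const
    have hψb : ∀ m t, |ψ m t| ≤ m := by
      intro m t
      simp only [hψ]
      split_ifs with h
      · exact h
      · simp
    have h := fun m => ae_exists_tendsto_sum (μ := μ) (ζ := fun k ω => ψ m (ξ k ω))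
      (C := (m : ℝ) ^ 2)
      hD.measurable (fun k => (hψm m).comp (hξm k)) hD.indep
      (fun k => (hind k).comp (φ := fun (v : Fin (k + 1) → ℝ) s => ψ m (v s)) (ψ := id)
        (measurable_pi_lambda _ fun s => (hψm m).comp (measurable_pi_apply s)) measurable_id)
      hφm hφ1 (fun k => hD.integral_apply k r)
      (fun k => MemLp.of_bound ((hψm m).comp (hξm k)).aestronglyMeasurable m
        (Eventually.of_forall fun ω => hψb m _))
      (fun k => by
        have h1 : ∀ ω, ψ m (ξ k ω) ^ 2 ≤ (m : ℝ) ^ 2 := fun ω =>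
          sq_le_sq' (abs_le.1 (hψb m _)).1 (abs_le.1 (hψb m _)).2
        have h2 := integral_mono_of_nonneg (μ := μ) (Eventually.of_forall fun ω => sq_nonneg _)
          (integrable_const _) (Eventually.of_forall h1)
        simpa using h2) hb
    filter_upwards [ae_all_iff.2 h, hbar] with ω h1 h2
    obtain ⟨m, hm⟩ := exists_nat_ge (ξbar ω)
    have e : ∀ k, ψ m (ξ k ω) = ξ k ω := fun k => if_pos ((h2 k).trans hm)
    simpa only [e] using h1 m
  · have hle := fun k => le_iSup (fun k => ∫⁻ ω, ENNReal.ofReal (ξ k ω ^ 2) ∂μ) k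
    have hint : ∀ k, Integrable (fun ω => ξ k ω ^ 2) μ := fun k =>
      (lintegral_ofReal_ne_top_iff_integrable ((hξm k).pow_const 2).aestronglyMeasurable
        (Eventually.of_forall fun ω => sq_nonneg _)).1 ((hle k).trans_lt hξ).ne
    refine ae_exists_tendsto_sum hD.measurable hξm hD.indep hind hφm hφ1
      (fun k => hD.integral_apply k r)
      (C := (⨆ k, ∫⁻ ω, ENNReal.ofReal (ξ k ω ^ 2) ∂μ).toReal)
      (fun k => (memLp_two_iff_integrable_sq (hξm k).aestronglyMeasurable).2 (hint k))
      (fun k => ?_) hb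
    rw [integral_eq_lintegral_of_nonneg_ae (Eventually.of_forall fun ω => sq_nonneg _)
      ((hξm k).pow_const 2).aestronglyMeasurable]
    exact ENNReal.toReal_mono hξ.ne (hle k)

end Probability

/-! ### Convexity and finite differences of the cost functions. -/

section Cost

lemma fderiv_le_of_convexOn {E : Type*} [NormedAddCommGroup E] [NormedSpace ℝ E] {f : E → ℝ}
    {f' : E →L[ℝ] ℝ} {x y : E} (hf : ConvexOn ℝ Set.univ f) (hx : HasFDerivAt f f' x) :
    f' (y - x) ≤ f y - f x := by
  have h1 : ConvexOn ℝ Set.univ (f ∘ AffineMap.lineMap (k := ℝ) x y) := by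
    simpa using hf.comp_affineMap (AffineMap.lineMap (k := ℝ) x y)
  have h2 : HasDerivAt (f ∘ AffineMap.lineMap (k := ℝ) x y) (f' (y - x)) 0 := by
    refine HasFDerivAt.comp_hasDerivAt (0 : ℝ) ?_ AffineMap.hasDerivAt_lineMap
    simpa using hx
  have h3 := h1.le_slope_of_hasDerivAt (Set.mem_univ 0) (Set.mem_univ 1) zero_lt_one h2
  simpa [slope_def_field] using h3

lemma continuous_gradient {E : Type*} [NormedAddCommGroup E] [InnerProductSpace ℝ E]
    [CompleteSpace E] {f : E → ℝ} (hf : ContDiff ℝ 1 f) : Continuous (gradient f) :=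
  (InnerProductSpace.toDual ℝ E).symm.continuous.comp (hf.continuous_fderiv one_ne_zero)

lemma inner_gradient {E : Type*} [NormedAddCommGroup E] [InnerProductSpace ℝ E]
    [CompleteSpace E] (f : E → ℝ) (x y : E) : inner ℝ (gradient f x) y = fderiv ℝ f x y := by
  simp [gradient]

/-- The tangent inequality for the total cost at `x`, evaluated at `xm`, combined with strict
minimality. The individual `c i` need not be convex. -/
lemma inner_average_gradient_pos {N : ℕ} (hN : 0 < N) {E : Type*} [NormedAddCommGroup E]
    [InnerProductSpace ℝ E] [CompleteSpace E] {c : Fin N → E → ℝ} {xm : E}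
    (hc : ∀ i, ContDiff ℝ 1 (c i)) (hconv : ConvexOn ℝ Set.univ fun x => ∑ i, c i x)
    (hmin : ∀ x, x ≠ xm → ∑ i, c i xm < ∑ i, c i x) (x : E) (hx : x ≠ xm) :
    0 < inner ℝ (average fun i => gradient (c i) x) (x - xm) := by
  have h1 : HasFDerivAt (fun x => ∑ i, c i x) (∑ i, fderiv ℝ (c i) x) x :=
    HasFDerivAt.fun_sum fun i _ => ((hc i).differentiable one_ne_zero x).hasFDerivAt
  have h2 := fderiv_le_of_convexOn (y := xm) hconv h1
  have h3 := hmin x hx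
  have h4 : inner ℝ (average fun i => gradient (c i) x) (x - xm) =
      (N : ℝ)⁻¹ * -((∑ i, fderiv ℝ (c i) x) (xm - x)) := by
    rw [← map_neg, neg_sub, average, real_inner_smul_left, sum_inner]
    simp
  rw [h4]
  have : (0 : ℝ) < N := by exact_mod_cast hN
  exact mul_pos (inv_pos.2 this) (by linarith)

/-- Uniform accuracy of symmetric difference quotients on bounded sets. -/
lemma exists_symmetric_difference_bound {E : Type*} [NormedAddCommGroup E] [InnerProductSpace ℝ E]
    [FiniteDimensional ℝ E] {f : E → ℝ} (hf : ContDiff ℝ 1 f) (K : ℝ) {R : ℝ} (hR : 0 ≤ R)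
    {ε : ℝ} (hε : 0 < ε) :
    ∃ δ, 0 < δ ∧ ∀ a, 0 < a → a < δ → ∀ x d, ‖x‖ ≤ K → ‖d‖ ≤ R →
      |f (x + a • d) - f (x - a • d) - 2 * a * inner ℝ (gradient f x) d| ≤ 2 * a * ε := by
  have hε' : 0 < ε / (R + 1) := by positivity
  obtain ⟨δ, hδ0, hδ⟩ := Metric.uniformContinuousOn_iff.1
    ((isCompact_closedBall (0 : E) (K + 1)).uniformContinuousOn_of_continuous
      (hf.continuous_fderiv one_ne_zero).continuousOn) _ hε'
  refine ⟨min δ 1 / (R + 1), by positivity, fun a ha ha' x d hx hd => ?_⟩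
  rw [lt_div_iff₀ (by positivity)] at ha'
  have haR : a * R < min δ 1 := lt_of_le_of_lt (by nlinarith) ha'
  have had : a * ‖d‖ ≤ a * R := mul_le_mul_of_nonneg_left hd ha.le
  have hb : ∀ y ∈ Metric.closedBall x (a * R), ‖fderiv ℝ f y - fderiv ℝ f x‖ ≤ ε / (R + 1) := by
    intro y hy
    rw [mem_closedBall_iff_norm] at hy
    rw [← dist_eq_norm]
    refine (hδ y ?_ x ?_ ?_).le
    · rw [mem_closedBall_zero_iff]
      have := norm_add_le (y - x) x
      rw [sub_add_cancel] at this
      have := min_le_right δ 1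
      linarith
    · rw [mem_closedBall_zero_iff]; linarith
    · rw [dist_eq_norm]
      have := min_le_left δ 1
      linarith
  -- The mean value inequality with the derivative at the centre `x` as reference gives an error
  -- small relative to `a` from continuity of the derivative alone.
  have h := Convex.norm_image_sub_le_of_norm_hasFDerivWithin_le'
    (f := f) (f' := fderiv ℝ f) (φ := fderiv ℝ f x) (x := x - a • d) (y := x + a • d)
    (fun y _ => ((hf.differentiable one_ne_zero y).hasFDerivAt).hasFDerivWithinAt) hb
    (convex_closedBall x (a * R))
    (by rw [mem_closedBall_iff_norm, sub_sub_cancel_left, norm_neg, norm_smul,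
          Real.norm_of_nonneg ha.le]; exact had)
    (by rw [mem_closedBall_iff_norm, add_sub_cancel_left, norm_smul,
          Real.norm_of_nonneg ha.le]; exact had)
  have e : x + a • d - (x - a • d) = (2 * a) • d := by module
  rw [e, map_smul, smul_eq_mul, norm_smul, Real.norm_of_nonneg (by positivity : 0 ≤ 2 * a),
    Real.norm_eq_abs, ← inner_gradient] at h
  refine h.trans ?_
  have h5 : ε / (R + 1) * ‖d‖ ≤ ε := by
    rw [div_mul_eq_mul_div, div_le_iff₀ (by positivity)]
    exact mul_le_mul_of_nonneg_left (by linarith) hε.le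
  calc ε / (R + 1) * (2 * a * ‖d‖) = 2 * a * (ε / (R + 1) * ‖d‖) := by ring
    _ ≤ _ := mul_le_mul_of_nonneg_left h5 (by positivity)

end Cost

/-! ### The Kiefer–Wolfowitz estimates as asymptotically unbiased observations. -/

section Observations

variable {N l : ℕ}

/-- The matrix unit `v ↦ v s • e r`. -/
noncomputable def matrixUnit (r s : Fin l) :
    EuclideanSpace ℝ (Fin l) →L[ℝ] EuclideanSpace ℝ (Fin l) :=
  (EuclideanSpace.proj s : EuclideanSpace ℝ (Fin l) →L[ℝ] ℝ).smulRight (EuclideanSpace.single r 1)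

/-- The operator `v ↦ ⟨d, v⟩ d - v`. -/
noncomputable def directionOperator (d : EuclideanSpace ℝ (Fin l)) :
    EuclideanSpace ℝ (Fin l) →L[ℝ] EuclideanSpace ℝ (Fin l) :=
  ∑ r, ∑ s, (d r * d s - if r = s then 1 else 0) • matrixUnit r s

lemma directionOperator_apply (d v : EuclideanSpace ℝ (Fin l)) :
    directionOperator d v = inner ℝ v d • d - v := by
  ext t
  simp [directionOperator, matrixUnit, PiLp.inner_apply, sub_smul, Finset.sum_sub_distrib,
    Finset.sum_apply, mul_comm, Pi.single_apply, Finset.mul_sum, mul_assoc]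

lemma eq_sum_smul_single (d : EuclideanSpace ℝ (Fin l)) :
    d = ∑ r, d r • EuclideanSpace.single r (1 : ℝ) := by
  ext t
  simp [Pi.single_apply]

lemma norm_le_of_sign {d : EuclideanSpace ℝ (Fin l)} (hd : ∀ r, d r = 1 ∨ d r = -1) :
    ‖d‖ ≤ √l := by
  rw [EuclideanSpace.norm_eq]
  refine Real.sqrt_le_sqrt (le_of_eq ?_)
  have : ∀ r, ‖d r‖ ^ 2 = 1 := fun r => by rcases hd r with h | h <;> simp [h]
  simp only [this, Finset.sum_const, Finset.card_univ, Fintype.card_fin, nsmul_eq_mul, mul_one]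

/-- The randomized Kiefer-Wolfowitz estimates on a sample path on which the two series of
perturbations converge. -/
lemma asymptoticallyUnbiased_kwObservation {γ α : ℕ → ℝ} (hα_pos : ∀ k, 0 < α k)
    (hα_lim : Tendsto α atTop (𝓝 0)) {c : Fin N → EuclideanSpace ℝ (Fin l) → ℝ}
    (hc : ∀ i, ContDiff ℝ 1 (c i)) {Δ : Fin N → ℕ → EuclideanSpace ℝ (Fin l)}
    {ep em : Fin N → ℕ → ℝ} (hΔ : ∀ i k r, Δ i k r = 1 ∨ Δ i k r = -1)
    (hS : ∀ i r s, ∃ t, Tendsto (fun n => ∑ k ∈ Finset.range n,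
      γ k * (Δ i k r * Δ i k s - if r = s then 1 else 0)) atTop (𝓝 t))
    (hn : ∀ i r, ∃ t, Tendsto (fun n => ∑ k ∈ Finset.range n,
      γ k / (2 * α k) * ((ep i k - em i k) * Δ i k r)) atTop (𝓝 t)) :
    AsymptoticallyUnbiased γ (fun i => gradient (c i))
      fun k i => kwObservation (c i) (α k) (Δ i k) (ep i k) (em i k) := by
  refine ⟨fun k i => directionOperator (Δ i k),
    fun k i => -(((ep i k - em i k) / (2 * α k)) • Δ i k), ?_, fun i => ?_, fun i => ?_, ?_⟩
  · refine ⟨∑ r : Fin l, ∑ s : Fin l, 2 * ‖matrixUnit r s‖, fun k i => ?_⟩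
    refine norm_sum_le_of_le _ fun r _ => norm_sum_le_of_le _ fun s _ => ?_
    rw [norm_smul]
    refine mul_le_mul_of_nonneg_right ?_ (norm_nonneg _)
    rcases hΔ i k r with h | h <;> rcases hΔ i k s with h' | h' <;> rw [h, h'] <;>
      split_ifs <;> norm_num
  · choose t ht using hS i
    refine ⟨∑ r, ∑ s, t r s • matrixUnit r s, ?_⟩
    have e : (fun m => ∑ k ∈ Finset.range m, γ k • directionOperator (Δ i k)) =
        fun m => ∑ r, ∑ s, (∑ k ∈ Finset.range m,
          γ k * (Δ i k r * Δ i k s - if r = s then 1 else 0)) • matrixUnit r s := by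
      funext m
      simp only [directionOperator, Finset.smul_sum, smul_smul]
      rw [Finset.sum_comm]
      refine Finset.sum_congr rfl fun r _ => ?_
      rw [Finset.sum_comm]
      exact Finset.sum_congr rfl fun s _ => (Finset.sum_smul ..).symm
    rw [e]
    exact tendsto_finsetSum _ fun r _ => tendsto_finsetSum _ fun s _ => (ht r s).smul_const _
  · choose t ht using hn i
    refine ⟨-∑ r, t r • EuclideanSpace.single r (1 : ℝ), ?_⟩
    have e : (fun m => ∑ k ∈ Finset.range m,
        γ k • -(((ep i k - em i k) / (2 * α k)) • Δ i k)) =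
        fun m => -∑ r, (∑ k ∈ Finset.range m,
          γ k / (2 * α k) * ((ep i k - em i k) * Δ i k r)) • EuclideanSpace.single r (1 : ℝ) := by
      funext m
      simp only [smul_neg, Finset.sum_neg_distrib, Finset.sum_smul]
      rw [Finset.sum_comm (s := Finset.univ)]
      congr 1
      refine Finset.sum_congr rfl fun k _ => ?_
      conv_lhs => rw [eq_sum_smul_single (Δ i k)]
      simp_rw [Finset.smul_sum, smul_smul]
      refine Finset.sum_congr rfl fun r _ => ?_
      congr 1
      ring
    rw [e]
    exact (tendsto_finsetSum _ fun r _ => (ht r).smul_const _).neg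
  · intro K ε hε
    refine eventually_all.2 fun i => ?_
    have hR : 0 ≤ √(l : ℝ) := Real.sqrt_nonneg _
    obtain ⟨δ, hδ0, hδ⟩ := exists_symmetric_difference_bound (hc i) K hR
      (show 0 < ε / (√l + 1) by positivity)
    filter_upwards [hα_lim.eventually_lt_const hδ0] with k hk x hx
    have hα := hα_pos k
    have hd := norm_le_of_sign (hΔ i k)
    have h1 := hδ (α k) hα hk x (Δ i k) hx hd
    set A := c i (x + α k • Δ i k) - c i (x - α k • Δ i k) with hA
    -- The terms `⟨g, Δ⟩ Δ` and the noise cancel exactly, leaving only the difference-quotient error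
    -- times `Δ`, whose norm is at most `√l`.
    have e : kwObservation (c i) (α k) (Δ i k) (ep i k) (em i k) x + (gradient (c i) x +
        directionOperator (Δ i k) (gradient (c i) x)) -
        -(((ep i k - em i k) / (2 * α k)) • Δ i k) =
        -((A - 2 * α k * inner ℝ (gradient (c i) x) (Δ i k)) / (2 * α k)) • Δ i k := by
      rw [directionOperator_apply, add_sub_cancel, kwObservation, sub_neg_eq_add, ← neg_smul,
        ← add_smul, ← add_smul, hA]
      congr 1
      field_simp
      ring
    rw [e, norm_smul, norm_neg, norm_div, Real.norm_eq_abs,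
      Real.norm_of_nonneg (by positivity : 0 ≤ 2 * α k)]
    have h2 : |A - 2 * α k * inner ℝ (gradient (c i) x) (Δ i k)| / (2 * α k) ≤ ε / (√l + 1) := by
      rw [div_le_iff₀ (by positivity), mul_comm (ε / _)]
      exact h1
    refine (mul_le_mul h2 hd (norm_nonneg _) (by positivity)).trans ?_
    rw [div_mul_eq_mul_div, div_le_iff₀ (by positivity)]
    exact mul_le_mul_of_nonneg_left (by linarith) hε.le

end Observations
end DSAAWET

theorem mainTheorem3 {N l : ℕ} {Ω : Type*} [MeasurableSpace Ω]
    (μ : Measure Ω) [IsProbabilityMeasure μ]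
    -- the network
    (W : ℕ → Matrix (Fin N) (Fin N) ℝ) (hW : DSAAWET.NetworkCondition W)
    -- the truncation bounds and the reset point
    (M : ℕ → ℝ) (xstar : EuclideanSpace ℝ (Fin l))
    (hM_pos : ∀ k, 0 < M k) (hM_mono : Monotone M) (hM_top : Tendsto M atTop atTop)
    (hM_zero : ‖xstar‖ ≤ M 0)
    -- the step sizes
    (γ α : ℕ → ℝ) (hγ_pos : ∀ k, 0 < γ k)
    (hγ_sum : Tendsto (fun n => ∑ k ∈ Finset.range n, γ k) atTop atTop)
    (hγ_pow : ∃ p : ℝ, 1 < p ∧ p ≤ 2 ∧ Summable (fun k => γ k ^ p))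
    (hα_pos : ∀ k, 0 < α k) (hα_lim : Tendsto α atTop (𝓝 0))
    (hγα : Summable (fun k => γ k ^ 2 / α k ^ 2))
    -- the cost functions
    (c : Fin N → EuclideanSpace ℝ (Fin l) → ℝ) (xmin : EuclideanSpace ℝ (Fin l))
    (hc_diff : ∀ i, ContDiff ℝ 1 (c i))
    (hc_lip : LocallyLipschitz (gradient (fun x => ∑ i, c i x)))
    (hc_conv : ConvexOn ℝ Set.univ (fun x => ∑ i, c i x))
    (hc_min : ∀ x, x ≠ xmin → ∑ i, c i xmin < ∑ i, c i x)
    (hc_star : ∃ c₀ : ℝ, 0 < c₀ ∧ ‖xstar‖ < c₀ ∧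
      ∑ i, c i xstar < sSup ((fun x => ∑ i, c i x) '' Metric.sphere 0 c₀))
    -- the random perturbations
    (Δ : Fin N → ℕ → Ω → EuclideanSpace ℝ (Fin l))
    (hΔ : ∀ i, DSAAWET.IsSignSequence (Δ i) μ)
    -- the observation noises
    (ξp ξm : Fin N → ℕ → Ω → ℝ)
    (hξp : ∀ i k, Measurable (ξp i (k + 1))) (hξm : ∀ i k, Measurable (ξm i (k + 1)))
    (hξ_indep : ∀ i k, IndepFun
      (fun ω (s : Fin (k + 1)) => ξp i (s + 1) ω - ξm i (s + 1) ω)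
      (fun ω (s : Fin (k + 1)) => Δ i s ω) μ)
    (hξ_bound : ∀ i,
      (∃ ξbar : Ω → ℝ, ∀ᵐ ω ∂μ, ∀ k, |ξp i (k + 1) ω - ξm i (k + 1) ω| ≤ ξbar ω) ∨
      (⨆ k, ∫⁻ ω, ENNReal.ofReal ((ξp i (k + 1) ω - ξm i (k + 1) ω) ^ 2) ∂μ) < ⊤)
    -- arbitrary, possibly random, initial values
    (x0 : Fin N → Ω → EuclideanSpace ℝ (Fin l)) :
    ∀ᵐ ω ∂μ, ∀ i, Tendsto
      (fun k => DSAAWET.gradientFreeEstimate W γ α M xstar c (fun j => x0 j ω)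
        (fun j m => Δ j m ω) (fun j m => ξp j m ω) (fun j m => ξm j m ω) i k)
      atTop (𝓝 xmin) := by
  have hα1 : ∀ᶠ k in atTop, α k < 1 := hα_lim.eventually_lt_const one_pos
  -- Eventually `α < 1`, so `γ² ≤ γ² / α²`. Square summability also gives `γ → 0`.
  have hγsq : Summable fun k => γ k ^ 2 := by
    refine Summable.of_norm_bounded_eventually_nat hγα ?_
    filter_upwards [hα1] with k hk
    have h0 := hα_pos k
    rw [Real.norm_of_nonneg (sq_nonneg _), le_div_iff₀ (by positivity)]
    exact mul_le_of_le_one_right (sq_nonneg _) (pow_le_one₀ h0.le hk.le)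
  have hγ_lim : Tendsto γ atTop (𝓝 0) := by
    have h1 := hγsq.tendsto_atTop_zero.sqrt
    simpa [Real.sqrt_sq (hγ_pos _).le] using h1
  have hb : Summable fun k => (γ k / (2 * α k)) ^ 2 := by
    refine (hγα.mul_left (1 / 4)).congr fun k => ?_
    rw [div_pow, mul_pow]
    ring
  have hsign : ∀ᵐ ω ∂μ, ∀ i k r, Δ i k ω r = 1 ∨ Δ i k ω r = -1 :=
    ae_all_iff.2 fun i => (hΔ i).ae_eq
  have hS := ae_all_iff.2 fun i => (hΔ i).ae_tendsto_sum_mul hγsq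
  have hn := ae_all_iff.2 fun i => (hΔ i).ae_tendsto_sum_noise hb
    (ξ := fun k ω => ξp i (k + 1) ω - ξm i (k + 1) ω)
    (fun k => (hξp i k).sub (hξm i k)) (hξ_indep i) (hξ_bound i)
  filter_upwards [hsign, hS, hn] with ω hsign hS hn i
  have hO := DSAAWET.asymptoticallyUnbiased_kwObservation hα_pos hα_lim hc_diff
    (Δ := fun i k => Δ i k ω) (ep := fun i k => ξp i (k + 1) ω) (em := fun i k => ξm i (k + 1) ω)
    hsign hS hn
  exact (DSAAWET.isTrajectory_algorithm (M := M) (xstar := xstar) fun j => x0 j ω).tendsto hW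
    hM_mono hM_top hO hγ_pos hγ_sum hγ_lim (fun i => DSAAWET.continuous_gradient (hc_diff i))
    (DSAAWET.inner_average_gradient_pos i.pos hc_diff hc_conv hc_min) i
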